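/- Let $\mathcal A$ be a finite nonempty set of $N$ agents and $\mathcal K$ a finite set of global constraints. For each $i\in\mathcal A$ let $\mathcal G_i\subset\mathbb R^{n_i}$ be nonempty, compact and convex, and let $\phi_i$ and $g_{i,k}$ ($k\in\mathcal K$) be real functions that are convex, Lipschitz continuous and differentiable on $\mathcal G_i$, with gradients $\nabla\phi_i$, $\nabla g_{i,k}$ there (differentiability is meant relative to $\mathcal G_i$; where $\mathcal G_i$ does not determine the gradient uniquely, any choice is allowed). Put $\mathcal G=\prod_i\mathcal G_i$, $[x]_+=\max(0,x)$, $g_k(\mathbf y)=\sum_i g_{i,k}(\mathbf y_i)$, let $\mu>0$ and $$\Phi(\mathbf y)=\sum_{i\in\mathcal A}\phi_i(\mathbf y_i)+\frac{\mu}{2N}\sum_{k\in\mathcal K}\big([g_k(\mathbf y)]_+\big)^2,\qquad \mathcal Y^*=\operatorname*{arg\,min}_{\mathbf y\in\mathcal G}\Phi(\mathbf y).$$ Let $W=[w_{ij}]_{i,j\in\mathcal A}$ be a doubly stochastic matrix whose associated directed graph (with an edge $i\to j$ iff $w_{ij}>0$) is strongly connected and aperiodic, i.e. some power $W^m$, $m\ge1$,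 has only positive entries. Let $\gamma_t\ge0$, $t=0,1,2,\dots$, be step sizes with $\sum_t\gamma_t=\infty$ and $\sum_t\gamma_t^2<\infty$. On a probability space, let $\mathbf y(t)$ and $\mathbf V(t)$ be random vectors in $\prod_i\mathbb R^{n_i}$ and $\mathbf e_i(t)\in\mathbb R^{\mathcal K}$ be such that $\mathbf y(0)\in\mathcal G$, $e_{i,k}(0)=g_{i,k}(\mathbf y_i(0))$ and, for all $t$, $i$, $k$, $$\mathbf y_i(t+1)=P_{\mathcal G_i}\big(\mathbf y_i(t)+\gamma_t\mathbf U_i(t)\big),\qquad \mathbf U_i(t)=-\nabla\phi_i(\mathbf y_i(t))-\mu\sum_{k\in\mathcal K}\nabla g_{i,k}(\mathbf y_i(t))\,[e_{i,k}(t)]_+ +\mathbf V_i(t),$$ $$e_{i,k}(t+1)=\sum_{j\in\mathcal A}w_{ij}e_{j,k}(t)+g_{i,k}(\mathbf y_i(t+1))-g_{i,k}(\mathbf y_i(t)),$$ where $P_{\mathcal G_i}$ is the Euclidean projection onto $\mathcal G_i$. Assume that there is a Markov kernel $\mathbf y\mapsto\nu_{\mathbf y}$ such that for every $t$ the conditional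 distribution of $\mathbf V(t)$ given $\mathbf y(t)=\mathbf y$ is $\nu_{\mathbf y}$, and that $\int\mathbf v\,\nu_{\mathbf y}(d\mathbf v)=\mathbf 0$ for every $\mathbf y\in\mathcal G$ and $\sup_{\mathbf y\in\mathcal G}\int\|\mathbf v\|_2^2\,\nu_{\mathbf y}(d\mathbf v)<\infty$. Then $\mathcal Y^*\neq\emptyset$ and, with $d_{\mathcal Y^*}(\mathbf y)=\inf\{\|\mathbf y-\mathbf y^*\|_2:\mathbf y^*\in\mathcal Y^*\}$, $$\mathbb P\Big(\lim_{t\to\infty}d_{\mathcal Y^*}(\mathbf y(t))=0\Big)=1.$$ -/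

import Mathlib

namespace PenaltyConsensus

/-- The space of joint decision vectors `y = (y_i)`, where agent `i` has `n i` real decision
variables, with the `ℓ²` norm of the concatenated vector. -/
abbrev Decision {ι : Type*} (n : ι → ℕ) : Type _ :=
  PiLp 2 fun i => EuclideanSpace ℝ (Fin (n i))

/-- The product `𝒢 = ∏ 𝒢_i` of the local constraint sets. -/
def feasibleSet {ι : Type*} {n : ι → ℕ} (G : ∀ i, Set (EuclideanSpace ℝ (Fin (n i)))) :
    Set (Decision n) :=
  {y | ∀ i, y i ∈ G i}

/-- The global constraint function `g_k(y) = ∑ i, g_{i,k}(y_i)`. -/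
def globalConstraint {ι κ : Type*} [Fintype ι] {n : ι → ℕ}
    (g : ∀ i, κ → EuclideanSpace ℝ (Fin (n i)) → ℝ) (k : κ) (y : Decision n) : ℝ :=
  ∑ i, g i k (y i)

/-- The penalized objective
`Φ(y) = ∑ i, φ_i(y_i) + μ / (2 N) * ∑ k, ([g_k(y)]_+)²`, with `N` the number of agents. -/
noncomputable def penalizedObjective {ι κ : Type*} [Fintype ι] [Fintype κ] {n : ι → ℕ}
    (φ : ∀ i, EuclideanSpace ℝ (Fin (n i)) → ℝ)
    (g : ∀ i, κ → EuclideanSpace ℝ (Fin (n i)) → ℝ) (μ : ℝ) (y : Decision n) : ℝ :=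
  ∑ i, φ i (y i) +
    μ / (2 * (Fintype.card ι : ℝ)) * ∑ k, (max 0 (globalConstraint g k y)) ^ 2

/-- The set of minimizers of the penalized objective over `𝒢`. -/
def optimalSet {ι κ : Type*} [Fintype ι] [Fintype κ] {n : ι → ℕ}
    (G : ∀ i, Set (EuclideanSpace ℝ (Fin (n i))))
    (φ : ∀ i, EuclideanSpace ℝ (Fin (n i)) → ℝ)
    (g : ∀ i, κ → EuclideanSpace ℝ (Fin (n i)) → ℝ) (μ : ℝ) : Set (Decision n) :=
  {y | y ∈ feasibleSet G ∧
    ∀ z ∈ feasibleSet G, penalizedObjective φ g μ y ≤ penalizedObjective φ g μ z}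

/-- `p` is the Euclidean projection of `x` onto `S` (unique if `S` is convex). -/
def IsEuclideanProj {E : Type*} [NormedAddCommGroup E] (S : Set E) (x p : E) : Prop :=
  p ∈ S ∧ ∀ q ∈ S, ‖x - p‖ ≤ ‖x - q‖

/-- The update direction of agent `i`,
`U_i = -∇φ_i(y_i) - μ ∑ k, [e_{i,k}]_+ ∇g_{i,k}(y_i) + V_i`. -/
noncomputable def updateDirection {ι κ : Type*} [Fintype κ] {n : ι → ℕ}
    (gradφ : ∀ i, EuclideanSpace ℝ (Fin (n i)) → EuclideanSpace ℝ (Fin (n i)))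
    (gradg : ∀ i, κ → EuclideanSpace ℝ (Fin (n i)) → EuclideanSpace ℝ (Fin (n i)))
    (μ : ℝ) (y : Decision n) (e : ι → κ → ℝ) (V : Decision n) (i : ι) :
    EuclideanSpace ℝ (Fin (n i)) :=
  -gradφ i (y i) - μ • ∑ k, max 0 (e i k) • gradg i k (y i) + V i

/-- The sequences `y(t)` (decisions) and `e(t)` (estimates of the constraint functions) are
generated by the algorithm from the perturbations `V(t)` with step sizes `γ_t`. -/
structure IsTrajectory {ι κ : Type*} [Fintype ι] [Fintype κ] {n : ι → ℕ}
    (G : ∀ i, Set (EuclideanSpace ℝ (Fin (n i))))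
    (gradφ : ∀ i, EuclideanSpace ℝ (Fin (n i)) → EuclideanSpace ℝ (Fin (n i)))
    (g : ∀ i, κ → EuclideanSpace ℝ (Fin (n i)) → ℝ)
    (gradg : ∀ i, κ → EuclideanSpace ℝ (Fin (n i)) → EuclideanSpace ℝ (Fin (n i)))
    (μ : ℝ) (W : Matrix ι ι ℝ) (γ : ℕ → ℝ)
    (V : ℕ → Decision n) (y : ℕ → Decision n) (e : ℕ → ι → κ → ℝ) : Prop where
  y_zero : y 0 ∈ feasibleSet G
  e_zero : ∀ i k, e 0 i k = g i k (y 0 i)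
  y_succ : ∀ t i, IsEuclideanProj (G i)
    (y t i + γ t • updateDirection gradφ gradg μ (y t) (e t) (V t) i) (y (t + 1) i)
  e_succ : ∀ t i k, e (t + 1) i k =
    ∑ j, W i j * e t j k + g i k (y (t + 1) i) - g i k (y t i)

end PenaltyConsensus

namespace PenaltyConsensus

open Filter Topology RealInnerProductSpace

/-! ### Real sequences -/

/-- A nonnegative sequence whose increments are bounded above by a summable sequence converges. -/
lemma exists_tendsto_of_le_add_summable {u a : ℕ → ℝ} (hu : ∀ t, 0 ≤ u t)
    (hstep : ∀ t, u (t + 1) ≤ u t + a t) (ha : Summable a) : ∃ l, Tendsto u atTop (𝓝 l) := by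
  have hanti : Antitone fun t => u t - ∑ s ∈ Finset.range t, a s := by
    refine antitone_nat_of_succ_le fun t => ?_
    rw [Finset.sum_range_succ]
    linarith [hstep t]
  have hsum := ha.hasSum.tendsto_sum_nat
  obtain ⟨B, hB⟩ := hsum.bddAbove_range
  have hbdd : BddBelow (Set.range fun t => u t - ∑ s ∈ Finset.range t, a s) := by
    refine ⟨-B, ?_⟩
    rintro _ ⟨t, rfl⟩
    have := hB ⟨t, rfl⟩
    simp only at this ⊢
    linarith [hu t]
  refine ⟨_, ((tendsto_atTop_ciInf hanti hbdd).add hsum).congr fun t => ?_⟩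
  ring

/-- If a nonnegative sequence `f` grows by at most `L * s t` in step `t`, the weighted sum
`∑ s t * f t` is finite, `∑ s t ^ 2` is finite and `∑ s t` diverges, then `f` tends to zero. -/
lemma tendsto_zero_of_summable_mul {f s : ℕ → ℝ} {L : ℝ} (hf : ∀ t, 0 ≤ f t)
    (hs : ∀ t, 0 ≤ s t) (hstep : ∀ t, f (t + 1) ≤ f t + L * s t)
    (hsf : Summable fun t => s t * f t) (hs2 : Summable fun t => s t ^ 2)
    (hsum : ¬ Summable s) : Tendsto f atTop (𝓝 0) := by
  obtain ⟨l, hl⟩ : ∃ l, Tendsto (fun t => f t ^ 2) atTop (𝓝 l) := by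
    refine exists_tendsto_of_le_add_summable (a := fun t => 2 * L * (s t * f t) + L ^ 2 * s t ^ 2)
      (fun t => sq_nonneg _) (fun t => ?_) ((hsf.mul_left _).add (hs2.mul_left _))
    calc f (t + 1) ^ 2 ≤ (f t + L * s t) ^ 2 := pow_le_pow_left₀ (hf _) (hstep t) 2
      _ = _ := by ring
  have hfl : Tendsto f atTop (𝓝 (√l)) := by
    refine ((Real.continuous_sqrt.tendsto l).comp hl).congr fun t => ?_
    simp [Real.sqrt_sq (hf t)]
  rcases (Real.sqrt_nonneg l).eq_or_lt with h0 | hpos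
  · rwa [← h0] at hfl
  · refine absurd ?_ hsum
    have hev : ∀ᶠ t in atTop, √l / 2 < f t := hfl.eventually_const_lt (by linarith)
    obtain ⟨T, hT⟩ := eventually_atTop.1 hev
    rw [← summable_nat_add_iff T]
    refine Summable.of_nonneg_of_le (fun t => hs _) (fun t => ?_)
      (((summable_nat_add_iff T).2 hsf).mul_left (2 / √l))
    have h1 := hT (t + T) (Nat.le_add_left _ _)
    rw [← mul_assoc, div_mul_eq_mul_div, div_mul_eq_mul_div, le_div_iff₀ hpos]
    nlinarith [hs (t + T)]

/-- A sequence contracted at rate `ρ` up to perturbations `q`, paired with weights `γ`. -/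
lemma sum_mul_le_of_contraction {γ ε q : ℕ → ℝ} {ρ : ℝ} (hρ0 : 0 ≤ ρ) (hρ1 : ρ < 1)
    (hε : ∀ t, 0 ≤ ε t) (hstep : ∀ t, ε (t + 1) ≤ ρ * ε t + q t) (T : ℕ) :
    ∑ t ∈ Finset.range T, γ t * ε t ≤
      ε 0 ^ 2 / (1 - ρ) + ∑ t ∈ Finset.range T, (γ t ^ 2 + q t ^ 2 / (1 - ρ) ^ 2) := by
  have h1 : 0 < 1 - ρ := by linarith
  have key : ∀ t, ε (t + 1) ^ 2 ≤ ρ * ε t ^ 2 + q t ^ 2 / (1 - ρ) := by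
    intro t
    have h2 : ε (t + 1) ^ 2 ≤ (ρ * ε t + q t) ^ 2 := pow_le_pow_left₀ (hε _) (hstep t) 2
    have h3 : q t ^ 2 / (1 - ρ) * (1 - ρ) = q t ^ 2 := by field_simp
    have h4 : (ρ * ε t + q t) ^ 2 + ρ / (1 - ρ) * ((1 - ρ) * ε t - q t) ^ 2
        = ρ * ε t ^ 2 + q t ^ 2 / (1 - ρ) := by
      field_simp
      ring
    have h5 : 0 ≤ ρ / (1 - ρ) * ((1 - ρ) * ε t - q t) ^ 2 := by positivity
    linarith
  have hmain : ∀ T, ∑ t ∈ Finset.range T, γ t * ε t + ε T ^ 2 / (1 - ρ) ≤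
      ε 0 ^ 2 / (1 - ρ) + ∑ t ∈ Finset.range T, (γ t ^ 2 + q t ^ 2 / (1 - ρ) ^ 2) := by
    intro T
    induction T with
    | zero => simp
    | succ T ih =>
      rw [Finset.sum_range_succ, Finset.sum_range_succ]
      have h2 : ε (T + 1) ^ 2 / (1 - ρ) ≤ ε T ^ 2 / (1 - ρ) - ε T ^ 2 + q T ^ 2 / (1 - ρ) ^ 2 := by
        rw [div_le_iff₀ h1]
        refine (key T).trans (le_of_eq ?_)
        field_simp
        ring
      nlinarith [sq_nonneg (γ T - ε T), sq_nonneg (γ T), sq_nonneg (ε T)]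
  have : 0 ≤ ε T ^ 2 / (1 - ρ) := by positivity
  linarith [hmain T]

lemma le_of_contraction {ε : ℕ → ℝ} {ρ c E : ℝ} (hρ0 : 0 ≤ ρ) (h0 : ε 0 ≤ E)
    (hE : ρ * E + c ≤ E) (hstep : ∀ t, ε (t + 1) ≤ ρ * ε t + c) (t : ℕ) : ε t ≤ E := by
  induction t with
  | zero => exact h0
  | succ t ih => linarith [hstep t, mul_le_mul_of_nonneg_left ih hρ0]

/-! ### Mixing of primitive doubly stochastic matrices -/

/-- A gauge on `ι → ℝ`, equivalent to the `ℓ¹` norm, for which `W` is a strict contraction on the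
vectors of zero sum. -/
structure IsMixingGauge {ι : Type*} [Fintype ι] (W : Matrix ι ι ℝ) (r : (ι → ℝ) → ℝ)
    (ρ K : ℝ) : Prop where
  rate_nonneg : 0 ≤ ρ
  rate_lt_one : ρ < 1
  const_nonneg : 0 ≤ K
  contract : ∀ x : ι → ℝ, ∑ i, x i = 0 → r (W.mulVec x) ≤ ρ * r x
  add_le : ∀ x z, r (x + z) ≤ r x + r z
  sum_abs_le : ∀ x : ι → ℝ, ∑ i, |x i| ≤ r x
  le_sum_abs : ∀ x : ι → ℝ, r x ≤ K * ∑ i, |x i|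

lemma sum_abs_mulVec_le_of_le {ι : Type*} [Fintype ι] [DecidableEq ι] {A : Matrix ι ι ℝ}
    (hA : A ∈ doublyStochastic ℝ ι) {δ : ℝ} (hδ : ∀ i j, δ ≤ A i j) {x : ι → ℝ}
    (hx : ∑ i, x i = 0) :
    ∑ i, |A.mulVec x i| ≤ (1 - Fintype.card ι * δ) * ∑ i, |x i| := by
  have h1 : ∀ i, A.mulVec x i = ∑ j, (A i j - δ) * x j := by
    intro i
    simp only [Matrix.mulVec, dotProduct, sub_mul, Finset.sum_sub_distrib, ← Finset.mul_sum, hx]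
    simp
  calc ∑ i, |A.mulVec x i| ≤ ∑ i, ∑ j, (A i j - δ) * |x j| := by
        refine Finset.sum_le_sum fun i _ => ?_
        rw [h1]
        refine (Finset.abs_sum_le_sum_abs _ _).trans (Finset.sum_le_sum fun j _ => ?_)
        rw [abs_mul, abs_of_nonneg (sub_nonneg.2 (hδ i j))]
    _ = ∑ j, (∑ i, (A i j - δ)) * |x j| := by
        rw [Finset.sum_comm]
        simp_rw [Finset.sum_mul]
    _ = _ := by
        simp_rw [Finset.sum_sub_distrib, sum_col_of_mem_doublyStochastic hA]
        simp [Finset.mul_sum]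

lemma exists_isMixingGauge {ι : Type*} [Fintype ι] [DecidableEq ι] [Nonempty ι]
    {W : Matrix ι ι ℝ} (hW : W ∈ doublyStochastic ℝ ι) (hprim : W.IsPrimitive) :
    ∃ r ρ K, IsMixingGauge W r ρ K := by
  obtain ⟨m, hm, hpos⟩ := hprim.exists_pos_pow
  have hWj : ∀ j, W ^ j ∈ doublyStochastic ℝ ι := fun j => pow_mem hW j
  obtain ⟨δ, hδ0, hδ⟩ : ∃ δ > 0, ∀ i j, δ ≤ (W ^ m) i j := by
    obtain ⟨p, hp⟩ := Finite.exists_min fun p : ι × ι => (W ^ m) p.1 p.2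
    exact ⟨_, hpos p.1 p.2, fun i j => hp (i, j)⟩
  set N : ℝ := (Fintype.card ι : ℝ) with hN
  have hN1 : 1 ≤ N := by
    rw [hN]
    exact_mod_cast Fintype.card_pos
  have hNδ : N * δ ≤ 1 := by
    obtain ⟨i⟩ := ‹Nonempty ι›
    have := sum_row_of_mem_doublyStochastic (hWj m) i
    rw [← this, hN, ← nsmul_eq_mul, ← Finset.card_univ, ← Finset.sum_const]
    exact Finset.sum_le_sum fun j _ => hδ i j
  set ρ : ℝ := 1 - N * δ / 2 / m with hρ
  have hm1 : (1 : ℝ) ≤ m := by exact_mod_cast hm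
  have hpos' : 0 < N * δ := by positivity
  have hq : N * δ / 2 / m ≤ 1 / 2 := by
    rw [div_le_iff₀ (by positivity)]
    linarith
  have hq0 : 0 < N * δ / 2 / m := by positivity
  have hρ0 : 0 < ρ := by linarith
  have hρm : 1 - N * δ ≤ ρ ^ m := by
    have h := one_add_mul_le_pow (a := -(N * δ / 2 / m)) (by linarith) m
    have h2 : (m : ℝ) * -(N * δ / 2 / m) = -(N * δ / 2) := by field_simp
    rw [h2] at h
    rw [hρ, sub_eq_add_neg (1 : ℝ) (N * δ / 2 / m)]
    linarith
  have hlip : ∀ j x, ∑ i, |(W ^ j).mulVec x i| ≤ ∑ i, |x i| := by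
    intro j x
    calc ∑ i, |(W ^ j).mulVec x i| ≤ ∑ i, ∑ l, (W ^ j) i l * |x l| := by
          refine Finset.sum_le_sum fun i _ => ?_
          simp only [Matrix.mulVec, dotProduct]
          refine (Finset.abs_sum_le_sum_abs _ _).trans (Finset.sum_le_sum fun l _ => ?_)
          rw [abs_mul, abs_of_nonneg (nonneg_of_mem_doublyStochastic (hWj j))]
      _ = ∑ l, |x l| := by
          rw [Finset.sum_comm]
          simp_rw [← Finset.sum_mul, sum_col_of_mem_doublyStochastic (hWj j), one_mul]
  obtain ⟨p, rfl⟩ : ∃ p, m = p + 1 := ⟨m - 1, by omega⟩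
  refine ⟨fun x => ∑ j ∈ Finset.range (p + 1), (ρ ^ j)⁻¹ * ∑ i, |(W ^ j).mulVec x i|, ρ,
    ∑ j ∈ Finset.range (p + 1), (ρ ^ j)⁻¹, hρ0.le, by linarith,
    Finset.sum_nonneg fun j _ => by positivity, ?_, ?_, ?_, ?_⟩
  · intro x hx
    simp only [Matrix.mulVec_mulVec, ← pow_succ]
    rw [Finset.sum_range_succ, Finset.sum_range_succ', mul_add, Finset.mul_sum (Finset.range p)]
    refine add_le_add (Finset.sum_le_sum fun j _ => le_of_eq ?_) ?_
    · rw [pow_succ ρ]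
      field_simp
    · have h := sum_abs_mulVec_le_of_le (hWj (p + 1)) hδ hx
      simp only [pow_zero, inv_one, one_mul, Matrix.one_mulVec]
      rw [inv_mul_le_iff₀ (by positivity), ← mul_assoc, ← pow_succ]
      exact h.trans (mul_le_mul_of_nonneg_right hρm (Finset.sum_nonneg fun _ _ => abs_nonneg _))
  · intro x z
    rw [← Finset.sum_add_distrib]
    refine Finset.sum_le_sum fun j _ => ?_
    rw [← mul_add, ← Finset.sum_add_distrib]
    refine mul_le_mul_of_nonneg_left (Finset.sum_le_sum fun i _ => ?_) (by positivity)
    rw [Matrix.mulVec_add]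
    exact abs_add_le _ _
  · intro x
    rw [Finset.sum_range_succ']
    simp only [pow_zero, inv_one, one_mul, Matrix.one_mulVec]
    exact le_add_of_nonneg_left (Finset.sum_nonneg fun j _ =>
      mul_nonneg (by positivity) (Finset.sum_nonneg fun _ _ => abs_nonneg _))
  · intro x
    rw [Finset.sum_mul]
    exact Finset.sum_le_sum fun j _ => mul_le_mul_of_nonneg_left (hlip j x) (by positivity)

/-! ### Convex functions with gradients relative to a convex set -/

/-- The first-order properties on `S` of a convex, `L`-Lipschitz function `f` with gradient `f'`. -/
structure IsLipschitzSubgradient {E : Type*} [NormedAddCommGroup E] [InnerProductSpace ℝ E]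
    (S : Set E) (L : ℝ) (f : E → ℝ) (f' : E → E) : Prop where
  abs_sub_le : ∀ x ∈ S, ∀ p ∈ S, |f p - f x| ≤ L * ‖p - x‖
  abs_inner_le : ∀ x ∈ S, ∀ p ∈ S, |⟪f' x, p - x⟫| ≤ L * ‖p - x‖
  inner_le : ∀ x ∈ S, ∀ p ∈ S, ⟪f' x, p - x⟫ ≤ f p - f x

lemma IsLipschitzSubgradient.mono {E : Type*} [NormedAddCommGroup E] [InnerProductSpace ℝ E]
    {S : Set E} {L L' : ℝ} {f : E → ℝ} {f' : E → E} (h : IsLipschitzSubgradient S L f f')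
    (hL : L ≤ L') : IsLipschitzSubgradient S L' f f' where
  abs_sub_le x hx p hp := (h.abs_sub_le x hx p hp).trans (by gcongr)
  abs_inner_le x hx p hp := (h.abs_inner_le x hx p hp).trans (by gcongr)
  inner_le := h.inner_le

lemma inner_gradient_le_of_forall_le {E : Type*} [NormedAddCommGroup E] [InnerProductSpace ℝ E]
    [CompleteSpace E] {S : Set E} (hS : Convex ℝ S) {f : E → ℝ} {v x p : E} (hx : x ∈ S)
    (hp : p ∈ S) (hf : HasGradientWithinAt f v S x) {c : ℝ}
    (hc : ∀ s ∈ Set.Ioc (0 : ℝ) 1, f (x + s • (p - x)) - f x ≤ s * c) : ⟪v, p - x⟫ ≤ c := by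
  have hmem : ∀ s ∈ Set.Icc (0 : ℝ) 1, x + s • (p - x) ∈ S := fun s hs =>
    hS.add_smul_sub_mem hx hp hs
  have hline : HasDerivWithinAt (fun s : ℝ => x + s • (p - x)) (p - x) (Set.Icc 0 1) 0 := by
    simpa using (((hasDerivAt_id (0 : ℝ)).smul_const (p - x)).const_add x).hasDerivWithinAt
  have hderiv : HasDerivWithinAt (fun s : ℝ => f (x + s • (p - x))) ⟪v, p - x⟫ (Set.Icc 0 1) 0 := by
    have hf' : HasFDerivWithinAt f (InnerProductSpace.toDual ℝ E v) S (x + (0 : ℝ) • (p - x)) := by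
      simpa using hf.hasFDerivWithinAt
    have h := hf'.comp_hasDerivWithinAt (0 : ℝ) hline hmem
    rw [InnerProductSpace.toDual_apply_apply] at h
    exact h
  rw [hasDerivWithinAt_iff_tendsto_slope] at hderiv
  have hset : Set.Icc (0 : ℝ) 1 \ {0} = Set.Ioc 0 1 := by
    rw [Set.Icc_sdiff_left]
  rw [hset] at hderiv
  have : (𝓝[Set.Ioc (0 : ℝ) 1] 0).NeBot := by
    rw [nhdsWithin_Ioc_eq_nhdsGT zero_lt_one]
    infer_instance
  refine le_of_tendsto hderiv ?_
  filter_upwards [self_mem_nhdsWithin] with s hs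
  rw [slope_def_field, sub_zero, div_le_iff₀ hs.1]
  simpa [mul_comm] using hc s hs

lemma isLipschitzSubgradient_of_hasGradientWithinAt {E : Type*} [NormedAddCommGroup E]
    [InnerProductSpace ℝ E] [CompleteSpace E] {S : Set E} {f : E → ℝ} {f' : E → E} {L : NNReal}
    (hconv : ConvexOn ℝ S f) (hlip : LipschitzOnWith L f S)
    (hgrad : ∀ x ∈ S, HasGradientWithinAt f (f' x) S x) : IsLipschitzSubgradient S L f f' := by
  have habs : ∀ x ∈ S, ∀ p ∈ S, |f p - f x| ≤ L * ‖p - x‖ := fun x hx p hp => by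
    simpa [Real.dist_eq, dist_eq_norm] using hlip.dist_le_mul p hp x hx
  have hseg : ∀ x ∈ S, ∀ p ∈ S, ∀ s ∈ Set.Ioc (0 : ℝ) 1,
      |f (x + s • (p - x)) - f x| ≤ s * (L * ‖p - x‖) := by
    intro x hx p hp s hs
    refine (habs x hx _ (hconv.1.add_smul_sub_mem hx hp ⟨hs.1.le, hs.2⟩)).trans (le_of_eq ?_)
    rw [add_sub_cancel_left, norm_smul, Real.norm_of_nonneg hs.1.le]
    ring
  refine ⟨habs, fun x hx p hp => abs_le'.2 ⟨?_, ?_⟩, fun x hx p hp => ?_⟩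
  · exact inner_gradient_le_of_forall_le hconv.1 hx hp (hgrad x hx) fun s hs =>
      (le_abs_self _).trans (hseg x hx p hp s hs)
  · have hneg : HasGradientWithinAt (fun x => -f x) (-f' x) S x := by
      rw [hasGradientWithinAt_iff_hasFDerivWithinAt, map_neg]
      exact (hgrad x hx).hasFDerivWithinAt.neg
    rw [← inner_neg_left]
    refine inner_gradient_le_of_forall_le hconv.1 hx hp hneg fun s hs => ?_
    refine le_trans ?_ (hseg x hx p hp s hs)
    rw [abs_sub_comm]
    exact le_trans (by linarith) (le_abs_self _)
  · refine inner_gradient_le_of_forall_le hconv.1 hx hp (hgrad x hx) fun s hs => ?_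
    have h := hconv.2 hx hp (sub_nonneg.2 hs.2) hs.1.le (by ring)
    have heq : (1 - s) • x + s • p = x + s • (p - x) := by
      rw [sub_smul, smul_sub, one_smul]
      abel
    rw [heq] at h
    simp only [smul_eq_mul] at h
    linarith

/-! ### Projected steps -/

lemma IsEuclideanProj.inner_sub_le {E : Type*} [NormedAddCommGroup E] [InnerProductSpace ℝ E]
    {S : Set E} (hS : Convex ℝ S) {x p z : E} (h : IsEuclideanProj S x p) (hz : z ∈ S) :
    ⟪x - p, z - p⟫ ≤ 0 := by
  have : Nonempty S := ⟨⟨p, h.1⟩⟩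
  refine (norm_eq_iInf_iff_real_inner_le_zero hS h.1).1 (le_antisymm ?_ ?_) z hz
  · exact le_ciInf fun w => h.2 w w.2
  · exact ciInf_le ⟨0, by rintro _ ⟨w, rfl⟩; exact norm_nonneg _⟩ (⟨p, h.1⟩ : S)

/-- A projected step along `U` moves by at most `γ * M` if `U` has slope at most `M` in the
direction of the step. -/
lemma IsEuclideanProj.norm_step_le {E : Type*} [NormedAddCommGroup E] [InnerProductSpace ℝ E]
    {S : Set E} (hS : Convex ℝ S) {x p U : E} {γ M : ℝ} (hγ : 0 ≤ γ) (hx : x ∈ S)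
    (h : IsEuclideanProj S (x + γ • U) p) (hM : 0 ≤ M) (hU : ⟪U, p - x⟫ ≤ M * ‖p - x‖) :
    ‖p - x‖ ≤ γ * M := by
  have h1 := h.inner_sub_le hS hx
  have h2 : ⟪x + γ • U - p, x - p⟫ = ‖p - x‖ ^ 2 - γ * ⟪U, p - x⟫ := by
    rw [show x + γ • U - p = -(p - x) + γ • U by abel, show x - p = -(p - x) by abel,
      inner_add_left, inner_neg_neg, real_inner_self_eq_norm_sq, inner_neg_right,
      real_inner_smul_left]
    ring
  have h3 : ‖p - x‖ * ‖p - x‖ ≤ (γ * M) * ‖p - x‖ := by nlinarith [mul_le_mul_of_nonneg_left hU hγ]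
  rcases (norm_nonneg (p - x)).eq_or_lt with h0 | h0
  · rw [← h0]
    positivity
  · exact le_of_mul_le_mul_right h3 h0

lemma IsEuclideanProj.norm_sub_sq_le {E : Type*} [NormedAddCommGroup E] [InnerProductSpace ℝ E]
    {S : Set E} (hS : Convex ℝ S) {x p z U : E} {γ M : ℝ} (hγ : 0 ≤ γ) (hz : z ∈ S)
    (h : IsEuclideanProj S (x + γ • U) p) (hU : ⟪U, p - x⟫ ≤ M * ‖p - x‖) :
    ‖p - z‖ ^ 2 ≤ ‖x - z‖ ^ 2 + 2 * γ * ⟪U, x - z⟫ + γ ^ 2 * M ^ 2 := by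
  have h1 := h.inner_sub_le hS hz
  have h2 : ⟪x + γ • U - p, z - p⟫ =
      ‖p - x‖ ^ 2 + ⟪p - x, x - z⟫ - γ * ⟪U, x - z⟫ - γ * ⟪U, p - x⟫ := by
    rw [show x + γ • U - p = -(p - x) + γ • U by abel,
      show z - p = -((p - x) + (x - z)) by abel,
      inner_add_left, inner_neg_neg, inner_neg_right, inner_add_right, inner_add_right,
      real_inner_self_eq_norm_sq, real_inner_smul_left, real_inner_smul_left]
    ring
  have h3 : ‖p - z‖ ^ 2 = ‖p - x‖ ^ 2 + 2 * ⟪p - x, x - z⟫ + ‖x - z‖ ^ 2 := by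
    rw [show p - z = (p - x) + (x - z) by abel, norm_add_sq_real]
  nlinarith [mul_le_mul_of_nonneg_left hU hγ, sq_nonneg (‖p - x‖ - γ * M)]

end PenaltyConsensus

namespace PenaltyConsensus

open Filter Topology RealInnerProductSpace

/-! ### Pathwise analysis of the algorithm -/

section Pathwise

variable {ι κ : Type*} {n : ι → ℕ}
  {G : ∀ i, Set (EuclideanSpace ℝ (Fin (n i)))}
  {φ : ∀ i, EuclideanSpace ℝ (Fin (n i)) → ℝ}
  {gradφ : ∀ i, EuclideanSpace ℝ (Fin (n i)) → EuclideanSpace ℝ (Fin (n i))}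
  {g : ∀ i, κ → EuclideanSpace ℝ (Fin (n i)) → ℝ}
  {gradg : ∀ i, κ → EuclideanSpace ℝ (Fin (n i)) → EuclideanSpace ℝ (Fin (n i))}
  {μ : ℝ} {W : Matrix ι ι ℝ} {γ : ℕ → ℝ}
  {V y : ℕ → Decision n} {e : ℕ → ι → κ → ℝ} {r : (ι → ℝ) → ℝ} {ρ K L D M : ℝ}

lemma inner_updateDirection [Fintype κ] (x : Decision n) (e : ι → κ → ℝ) (v : Decision n) (i : ι)
    (w : EuclideanSpace ℝ (Fin (n i))) :
    ⟪updateDirection gradφ gradg μ x e v i, w⟫ =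
      -⟪gradφ i (x i), w⟫ - μ * ∑ k, max 0 (e i k) * ⟪gradg i k (x i), w⟫ + ⟪v i, w⟫ := by
  simp only [updateDirection, inner_add_left, inner_sub_left, inner_neg_left, real_inner_smul_left,
    sum_inner]

variable [Fintype ι]

lemma sum_abs_sub_le (hg : ∀ i k, IsLipschitzSubgradient (G i) L (g i k) (gradg i k))
    (hL : 0 ≤ L) {x z : Decision n} (hx : x ∈ feasibleSet G) (hz : z ∈ feasibleSet G) (k : κ) :
    ∑ i, |g i k (z i) - g i k (x i)| ≤ Fintype.card ι * L * ‖z - x‖ := by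
  calc ∑ i, |g i k (z i) - g i k (x i)| ≤ ∑ _i : ι, L * ‖z - x‖ := by
        refine Finset.sum_le_sum fun i _ => ((hg i k).abs_sub_le _ (hx i) _ (hz i)).trans ?_
        gcongr
        exact PiLp.norm_apply_le (z - x) i
    _ = _ := by
        rw [Finset.sum_const, Finset.card_univ, nsmul_eq_mul, mul_assoc]

lemma abs_globalConstraint_div_card_le [Nonempty ι] (hM : ∀ i k, ∀ x ∈ G i, |g i k x| ≤ M)
    {x : Decision n} (hx : x ∈ feasibleSet G) (k : κ) :
    |globalConstraint g k x / Fintype.card ι| ≤ M := by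
  have hN : (0 : ℝ) < Fintype.card ι := by exact_mod_cast Fintype.card_pos
  rw [abs_div, abs_of_pos hN, div_le_iff₀ hN, mul_comm]
  refine (Finset.abs_sum_le_sum_abs _ _).trans
    ((Finset.sum_le_sum fun i _ => hM i k _ (hx i)).trans (le_of_eq ?_))
  rw [Finset.sum_const, Finset.card_univ, nsmul_eq_mul]

lemma max_zero_mul_sub_ge (a b : ℝ) : (max 0 a ^ 2 - max 0 b ^ 2) / 2 ≤ max 0 a * (a - b) := by
  have h1 : max 0 a * a = max 0 a ^ 2 := by
    rcases le_total 0 a with h | h <;> simp [h, sq]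
  have h2 : max 0 a * b ≤ max 0 a * max 0 b :=
    mul_le_mul_of_nonneg_left (le_max_right _ _) (le_max_left _ _)
  nlinarith [sq_nonneg (max 0 a - max 0 b)]

lemma sum_max_mul_inner_ge [Nonempty ι] (hL : 0 ≤ L)
    (hD : ∀ i, ∀ x ∈ G i, ∀ z ∈ G i, ‖x - z‖ ≤ D)
    (hg : ∀ i k, IsLipschitzSubgradient (G i) L (g i k) (gradg i k))
    {x z : Decision n} (hx : x ∈ feasibleSet G) (hz : z ∈ feasibleSet G) (e : ι → κ → ℝ) (k : κ) :
    (max 0 (globalConstraint g k x) ^ 2 - max 0 (globalConstraint g k z) ^ 2) /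
          (2 * Fintype.card ι) -
        L * D * ∑ i, |e i k - globalConstraint g k x / Fintype.card ι| ≤
      ∑ i, max 0 (e i k) * ⟪gradg i k (x i), x i - z i⟫ := by
  have hN : (0 : ℝ) < Fintype.card ι := by exact_mod_cast Fintype.card_pos
  set a := globalConstraint g k x with ha
  set b := globalConstraint g k z with hb
  have hterm : ∀ i, max 0 a / Fintype.card ι * (g i k (x i) - g i k (z i)) -
      L * D * |e i k - a / Fintype.card ι| ≤ max 0 (e i k) * ⟪gradg i k (x i), x i - z i⟫ := by
    intro i
    have h1 : g i k (x i) - g i k (z i) ≤ ⟪gradg i k (x i), x i - z i⟫ := by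
      have := (hg i k).inner_le _ (hx i) _ (hz i)
      rw [← neg_sub (z i) (x i), inner_neg_right]
      linarith
    have h2 : |⟪gradg i k (x i), x i - z i⟫| ≤ L * D := by
      have := (hg i k).abs_inner_le _ (hx i) _ (hz i)
      rw [← neg_sub (z i) (x i), inner_neg_right, abs_neg]
      exact this.trans (mul_le_mul_of_nonneg_left (hD i _ (hz i) _ (hx i)) hL)
    have h3 : |max 0 (e i k) - max 0 a / Fintype.card ι| ≤ |e i k - a / Fintype.card ι| := by
      have : max 0 a / (Fintype.card ι : ℝ) = max 0 (a / Fintype.card ι) := by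
        rw [← max_div_div_right hN.le, zero_div]
      rw [this, max_comm 0, max_comm 0]
      exact abs_max_sub_max_le_abs _ _ _
    have h4 : 0 ≤ max 0 a / (Fintype.card ι : ℝ) := div_nonneg (le_max_left _ _) hN.le
    have h5 : -(|e i k - a / Fintype.card ι| * (L * D)) ≤
        (max 0 (e i k) - max 0 a / Fintype.card ι) * ⟪gradg i k (x i), x i - z i⟫ := by
      refine neg_le_of_abs_le ?_
      rw [abs_mul]
      exact mul_le_mul h3 h2 (abs_nonneg _) (abs_nonneg _)
    nlinarith [mul_le_mul_of_nonneg_left h1 h4]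
  refine le_trans ?_ (Finset.sum_le_sum fun i _ => hterm i)
  rw [Finset.sum_sub_distrib, ← Finset.mul_sum, ← Finset.mul_sum, Finset.sum_sub_distrib]
  refine sub_le_sub_right ?_ _
  change _ ≤ max 0 a / Fintype.card ι * (a - b)
  rw [mul_comm (2 : ℝ), ← div_div, div_right_comm, div_mul_eq_mul_div]
  exact div_le_div_of_nonneg_right (max_zero_mul_sub_ge a b) hN.le

variable [Fintype κ]

/-- The disagreement of the estimates `e` with the values `g_k(y) / N`, measured by `r`. -/
noncomputable def consensusError (g : ∀ i, κ → EuclideanSpace ℝ (Fin (n i)) → ℝ)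
    (r : (ι → ℝ) → ℝ) (y : Decision n) (e : ι → κ → ℝ) : ℝ :=
  ∑ k, r fun i => e i k - globalConstraint g k y / Fintype.card ι

lemma IsTrajectory.mem_feasibleSet (h : IsTrajectory G gradφ g gradg μ W γ V y e) (t : ℕ) :
    y t ∈ feasibleSet G := by
  cases t with
  | zero => exact h.y_zero
  | succ t => exact fun i => (h.y_succ t i).1

lemma IsTrajectory.sum_estimates [DecidableEq ι] (h : IsTrajectory G gradφ g gradg μ W γ V y e)
    (hW : W ∈ doublyStochastic ℝ ι) (t : ℕ) (k : κ) :
    ∑ i, e t i k = globalConstraint g k (y t) := by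
  induction t with
  | zero => simp [globalConstraint, h.e_zero]
  | succ t ih =>
    have h1 : ∑ i, ∑ j, W i j * e t j k = ∑ j, e t j k := by
      rw [Finset.sum_comm]
      simp_rw [← Finset.sum_mul, sum_col_of_mem_doublyStochastic hW, one_mul]
    simp only [h.e_succ, Finset.sum_sub_distrib, Finset.sum_add_distrib, h1, ih, globalConstraint]
    ring

lemma sum_sub_mean_eq_zero [Nonempty ι] (x : ι → ℝ) {a : ℝ} (ha : ∑ i, x i = a) :
    ∑ i, (x i - a / Fintype.card ι) = 0 := by
  rw [Finset.sum_sub_distrib, ha, Finset.sum_const, Finset.card_univ, nsmul_eq_mul,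
    mul_div_cancel₀ _ (by simp), sub_self]

lemma sum_abs_sub_mean_le [Nonempty ι] (x : ι → ℝ) :
    ∑ i, |x i - (∑ j, x j) / Fintype.card ι| ≤ 2 * ∑ i, |x i| := by
  have hN : (0 : ℝ) < Fintype.card ι := by exact_mod_cast Fintype.card_pos
  calc ∑ i, |x i - (∑ j, x j) / Fintype.card ι|
      ≤ ∑ i, (|x i| + (∑ j, |x j|) / Fintype.card ι) := by
        refine Finset.sum_le_sum fun i _ => (abs_sub _ _).trans ?_
        rw [abs_div, abs_of_pos hN]
        gcongr
        exact Finset.abs_sum_le_sum_abs _ _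
    _ = _ := by
        rw [Finset.sum_add_distrib, Finset.sum_const, Finset.card_univ, nsmul_eq_mul,
          mul_div_cancel₀ _ hN.ne']
        ring

lemma IsMixingGauge.nonneg (hr : IsMixingGauge W r ρ K) (x : ι → ℝ) : 0 ≤ r x :=
  (Finset.sum_nonneg fun _ _ => abs_nonneg _).trans (hr.sum_abs_le x)

lemma IsMixingGauge.consensusError_nonneg (hr : IsMixingGauge W r ρ K) (y : Decision n)
    (e : ι → κ → ℝ) : 0 ≤ consensusError g r y e :=
  Finset.sum_nonneg fun _ _ => hr.nonneg _

lemma IsMixingGauge.sum_abs_le_consensusError (hr : IsMixingGauge W r ρ K) (y : Decision n)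
    (e : ι → κ → ℝ) :
    ∑ k, ∑ i, |e i k - globalConstraint g k y / Fintype.card ι| ≤ consensusError g r y e :=
  Finset.sum_le_sum fun _ _ => hr.sum_abs_le _

lemma IsTrajectory.consensusError_succ_le [DecidableEq ι] [Nonempty ι]
    (h : IsTrajectory G gradφ g gradg μ W γ V y e) (hW : W ∈ doublyStochastic ℝ ι)
    (hr : IsMixingGauge W r ρ K) (hL : 0 ≤ L)
    (hg : ∀ i k, IsLipschitzSubgradient (G i) L (g i k) (gradg i k)) (t : ℕ) :
    consensusError g r (y (t + 1)) (e (t + 1)) ≤ ρ * consensusError g r (y t) (e t) +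
      Fintype.card κ * (K * (2 * (Fintype.card ι * L))) * ‖y (t + 1) - y t‖ := by
  have hK := hr.const_nonneg
  have hstep : ∀ k, r (fun i => e (t + 1) i k - globalConstraint g k (y (t + 1)) / Fintype.card ι) ≤
      ρ * r (fun i => e t i k - globalConstraint g k (y t) / Fintype.card ι) +
        K * (2 * (Fintype.card ι * L)) * ‖y (t + 1) - y t‖ := by
    intro k
    set x : ι → ℝ := fun i => e t i k - globalConstraint g k (y t) / Fintype.card ι with hx
    set d : ι → ℝ := fun i => g i k (y (t + 1) i) - g i k (y t i) with hd
    have hsplit : (fun i => e (t + 1) i k - globalConstraint g k (y (t + 1)) / Fintype.card ι) =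
        W.mulVec x + fun i => d i - (∑ j, d j) / Fintype.card ι := by
      funext i
      have h1 : W.mulVec x i =
          ∑ j, W i j * e t j k - globalConstraint g k (y t) / Fintype.card ι := by
        simp only [Matrix.mulVec, dotProduct, hx, mul_sub, Finset.sum_sub_distrib, ← Finset.sum_mul,
          sum_row_of_mem_doublyStochastic hW, one_mul]
      have h2 : ∑ j, d j = globalConstraint g k (y (t + 1)) - globalConstraint g k (y t) := by
        simp [hd, globalConstraint]
      rw [Pi.add_apply, h1, h2, h.e_succ]
      simp only [hd]
      ring
    rw [hsplit]
    refine (hr.add_le _ _).trans (add_le_add (hr.contract x ?_) ?_)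
    · exact sum_sub_mean_eq_zero _ (h.sum_estimates hW t k)
    · refine (hr.le_sum_abs _).trans ?_
      have h3 := sum_abs_sub_mean_le d
      have h4 := sum_abs_sub_le hg hL (h.mem_feasibleSet t) (h.mem_feasibleSet (t + 1)) k
      calc _ ≤ K * (2 * (Fintype.card ι * L * ‖y (t + 1) - y t‖)) := by
            refine mul_le_mul_of_nonneg_left (h3.trans ?_) hK
            linarith
        _ = _ := by ring
  refine (Finset.sum_le_sum fun k _ => hstep k).trans (le_of_eq ?_)
  rw [Finset.sum_add_distrib, ← Finset.mul_sum, Finset.sum_const, Finset.card_univ, nsmul_eq_mul,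
    consensusError]
  ring

lemma IsTrajectory.consensusError_zero_le [Nonempty ι]
    (h : IsTrajectory G gradφ g gradg μ W γ V y e) (hr : IsMixingGauge W r ρ K)
    (hM : ∀ i k, ∀ x ∈ G i, |g i k x| ≤ M) :
    consensusError g r (y 0) (e 0) ≤ Fintype.card κ * (K * (Fintype.card ι * (2 * M))) := by
  rw [consensusError, ← nsmul_eq_mul, ← Finset.card_univ (α := κ), ← Finset.sum_const]
  refine Finset.sum_le_sum fun k _ => (hr.le_sum_abs _).trans ?_
  refine mul_le_mul_of_nonneg_left ?_ hr.const_nonneg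
  rw [← nsmul_eq_mul (Fintype.card ι) (2 * M)]
  refine Finset.sum_le_card_nsmul _ _ _ fun i _ => (abs_sub _ _).trans ?_
  have h1 := abs_globalConstraint_div_card_le hM h.y_zero k
  have h2 := hM i k _ (h.y_zero i)
  rw [h.e_zero]
  linarith

lemma sum_max_estimates_le [Nonempty ι] (hr : IsMixingGauge W r ρ K)
    (hM : ∀ i k, ∀ x ∈ G i, |g i k x| ≤ M) {x : Decision n} (hx : x ∈ feasibleSet G)
    (e : ι → κ → ℝ) (i : ι) :
    ∑ k, max 0 (e i k) ≤ consensusError g r x e + Fintype.card κ * M := by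
  calc ∑ k, max 0 (e i k)
      ≤ ∑ k, (∑ j, |e j k - globalConstraint g k x / Fintype.card ι| + M) := by
        refine Finset.sum_le_sum fun k _ => ?_
        have h1 := abs_globalConstraint_div_card_le hM hx k
        have h2 : |e i k - globalConstraint g k x / Fintype.card ι| ≤
            ∑ j, |e j k - globalConstraint g k x / Fintype.card ι| :=
          Finset.single_le_sum (f := fun j => |e j k - globalConstraint g k x / Fintype.card ι|)
            (fun j _ => abs_nonneg _) (Finset.mem_univ i)
        have h3 := abs_nonneg (e i k - globalConstraint g k x / Fintype.card ι)
        have h4 := le_abs_self (e i k - globalConstraint g k x / Fintype.card ι)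
        have h5 := le_abs_self (globalConstraint g k x / Fintype.card ι)
        have h6 := abs_nonneg (globalConstraint g k x / Fintype.card ι)
        exact max_le (by linarith) (by linarith)
    _ ≤ _ := by
        rw [Finset.sum_add_distrib, Finset.sum_const, Finset.card_univ, nsmul_eq_mul]
        exact add_le_add_left (hr.sum_abs_le_consensusError x e) _

lemma inner_updateDirection_le (hμ : 0 < μ) (hL : 0 ≤ L)
    (hφ : ∀ i, IsLipschitzSubgradient (G i) L (φ i) (gradφ i))
    (hg : ∀ i k, IsLipschitzSubgradient (G i) L (g i k) (gradg i k))
    {x : Decision n} {e : ι → κ → ℝ} {v : Decision n} {i : ι} {p : EuclideanSpace ℝ (Fin (n i))}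
    (hx : x ∈ feasibleSet G) (hp : p ∈ G i) {S : ℝ} (hS : ∑ k, max 0 (e i k) ≤ S) :
    ⟪updateDirection gradφ gradg μ x e v i, p - x i⟫ ≤
      (L + μ * (S * L) + ‖v‖) * ‖p - x i‖ := by
  rw [inner_updateDirection]
  have h1 := neg_le_of_abs_le ((hφ i).abs_inner_le _ (hx i) _ hp)
  have h2 : -(S * (L * ‖p - x i‖)) ≤
      ∑ k, max 0 (e i k) * ⟪gradg i k (x i), p - x i⟫ := by
    have h3 : ∑ k, max 0 (e i k) * (L * ‖p - x i‖) ≤ S * (L * ‖p - x i‖) := by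
      rw [← Finset.sum_mul]
      exact mul_le_mul_of_nonneg_right hS (by positivity)
    have h4 : ∑ k, max 0 (e i k) * -(L * ‖p - x i‖) ≤
        ∑ k, max 0 (e i k) * ⟪gradg i k (x i), p - x i⟫ :=
      Finset.sum_le_sum fun k _ => mul_le_mul_of_nonneg_left
        (neg_le_of_abs_le ((hg i k).abs_inner_le _ (hx i) _ hp)) (le_max_left _ _)
    simp only [mul_neg, Finset.sum_neg_distrib] at h4
    linarith
  have h3 : ⟪v i, p - x i⟫ ≤ ‖v‖ * ‖p - x i‖ :=
    (real_inner_le_norm _ _).trans (mul_le_mul_of_nonneg_right (PiLp.norm_apply_le v i)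
      (norm_nonneg _))
  nlinarith [mul_le_mul_of_nonneg_left h2 hμ.le]

/-- The update direction is a descent direction for the penalized objective up to the
disagreement of the estimates and the perturbation. -/
lemma sum_inner_updateDirection_le [Nonempty ι] (hμ : 0 < μ) (hL : 0 ≤ L)
    (hD : ∀ i, ∀ x ∈ G i, ∀ z ∈ G i, ‖x - z‖ ≤ D) (hD0 : 0 ≤ D)
    (hφ : ∀ i, IsLipschitzSubgradient (G i) L (φ i) (gradφ i))
    (hg : ∀ i k, IsLipschitzSubgradient (G i) L (g i k) (gradg i k))
    (hr : IsMixingGauge W r ρ K) {x z : Decision n} (hx : x ∈ feasibleSet G)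
    (hz : z ∈ feasibleSet G) (e : ι → κ → ℝ) (v : Decision n) :
    ∑ i, ⟪updateDirection gradφ gradg μ x e v i, x i - z i⟫ ≤
      penalizedObjective φ g μ z - penalizedObjective φ g μ x + ⟪v, x - z⟫ +
        μ * (L * D) * consensusError g r x e := by
  simp only [inner_updateDirection, Finset.sum_add_distrib, Finset.sum_sub_distrib,
    ← Finset.mul_sum, Finset.sum_neg_distrib]
  have h1 : ∑ i, φ i (x i) - ∑ i, φ i (z i) ≤ ∑ i, ⟪gradφ i (x i), x i - z i⟫ := by
    rw [← Finset.sum_sub_distrib]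
    refine Finset.sum_le_sum fun i _ => ?_
    have := (hφ i).inner_le _ (hx i) _ (hz i)
    rw [← neg_sub (z i) (x i), inner_neg_right]
    linarith
  have h2 : ∑ i, ⟪v i, x i - z i⟫ = ⟪v, x - z⟫ := by
    rw [PiLp.inner_apply]
    rfl
  have h3 := Finset.sum_le_sum fun k (_ : k ∈ Finset.univ) =>
    sum_max_mul_inner_ge hL hD hg hx hz e k
  rw [Finset.sum_comm (f := fun k i => max 0 (e i k) * ⟪gradg i k (x i), x i - z i⟫),
    Finset.sum_sub_distrib, ← Finset.mul_sum, ← Finset.sum_div, Finset.sum_sub_distrib] at h3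
  have h4 := mul_le_mul_of_nonneg_left (hr.sum_abs_le_consensusError (g := g) x e)
    (mul_nonneg hL hD0)
  have h5 := mul_le_mul_of_nonneg_left (h3.trans' (sub_le_sub_left h4 _)) hμ.le
  rw [h2]
  simp only [penalizedObjective]
  have h6 : ∀ a b : ℝ, μ * ((a - b) / (2 * (Fintype.card ι : ℝ))) =
    μ / (2 * Fintype.card ι) * a - μ / (2 * Fintype.card ι) * b := fun a b => by ring
  rw [mul_sub, h6] at h5
  linarith

lemma norm_le_sum_norm (x : Decision n) : ‖x‖ ≤ ∑ i, ‖x i‖ := by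
  refine abs_le_of_sq_le_sq' ?_ (Finset.sum_nonneg fun i _ => norm_nonneg _) |>.2
  rw [PiLp.norm_sq_eq_of_L2]
  exact Finset.sum_sq_le_sq_sum_of_nonneg fun i _ => norm_nonneg _

lemma norm_sub_le_of_mem (hD : ∀ i, ∀ x ∈ G i, ∀ z ∈ G i, ‖x - z‖ ≤ D)
    {x z : Decision n} (hx : x ∈ feasibleSet G) (hz : z ∈ feasibleSet G) :
    ‖x - z‖ ≤ Fintype.card ι * D := by
  refine (norm_le_sum_norm _).trans
    ((Finset.sum_le_sum fun i _ => hD i _ (hx i) _ (hz i)).trans (le_of_eq ?_))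
  rw [Finset.sum_const, Finset.card_univ, nsmul_eq_mul]

lemma exists_consensusError_le [DecidableEq ι] [Nonempty ι] (hL : 0 ≤ L)
    (hD : ∀ i, ∀ x ∈ G i, ∀ z ∈ G i, ‖x - z‖ ≤ D) (hD0 : 0 ≤ D)
    (hM : ∀ i k, ∀ x ∈ G i, |g i k x| ≤ M) (hM0 : 0 ≤ M)
    (hg : ∀ i k, IsLipschitzSubgradient (G i) L (g i k) (gradg i k))
    (hW : W ∈ doublyStochastic ℝ ι) (hr : IsMixingGauge W r ρ K) :
    ∃ E : ℝ, 0 ≤ E ∧ ∀ V y e, IsTrajectory G gradφ g gradg μ W γ V y e →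
      ∀ t, consensusError g r (y t) (e t) ≤ E := by
  have hK := hr.const_nonneg
  have hρ0 := hr.rate_nonneg
  have hρ1 : 0 < 1 - ρ := sub_pos.2 hr.rate_lt_one
  set c : ℝ := Fintype.card κ * (K * (2 * (Fintype.card ι * L))) with hc
  have hc0 : 0 ≤ c := by positivity
  set E₀ : ℝ := Fintype.card κ * (K * (Fintype.card ι * (2 * M))) with hE₀
  have hE₀0 : 0 ≤ E₀ := by positivity
  refine ⟨E₀ + c * (Fintype.card ι * D) / (1 - ρ), by positivity, fun V y e h => ?_⟩
  refine le_of_contraction (ε := fun t => consensusError g r (y t) (e t)) hρ0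
    (c := c * (Fintype.card ι * D)) ?_ ?_ fun t =>
    (h.consensusError_succ_le hW hr hL hg t).trans ?_
  · have : 0 ≤ c * (Fintype.card ι * D) / (1 - ρ) := by positivity
    linarith [h.consensusError_zero_le hr hM]
  · have h1 : (1 - ρ) * (c * (Fintype.card ι * D) / (1 - ρ)) = c * (Fintype.card ι * D) := by
      field_simp
    linarith [mul_nonneg hρ1.le hE₀0]
  · have := mul_le_mul_of_nonneg_left
      (norm_sub_le_of_mem hD (h.mem_feasibleSet (t + 1)) (h.mem_feasibleSet t)) hc0
    linarith

lemma exists_slope_bound [DecidableEq ι] [Nonempty ι] (hμ : 0 < μ) (hL : 0 ≤ L)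
    (hD : ∀ i, ∀ x ∈ G i, ∀ z ∈ G i, ‖x - z‖ ≤ D) (hD0 : 0 ≤ D)
    (hM : ∀ i k, ∀ x ∈ G i, |g i k x| ≤ M) (hM0 : 0 ≤ M)
    (hφ : ∀ i, IsLipschitzSubgradient (G i) L (φ i) (gradφ i))
    (hg : ∀ i k, IsLipschitzSubgradient (G i) L (g i k) (gradg i k))
    (hW : W ∈ doublyStochastic ℝ ι) (hr : IsMixingGauge W r ρ K) :
    ∃ A : ℝ, 0 ≤ A ∧ ∀ V y e, IsTrajectory G gradφ g gradg μ W γ V y e →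
      ∀ t i, ⟪updateDirection gradφ gradg μ (y t) (e t) (V t) i, y (t + 1) i - y t i⟫ ≤
        A * (1 + ‖V t‖) * ‖y (t + 1) i - y t i‖ := by
  obtain ⟨E, hE0, hE⟩ := exists_consensusError_le (gradφ := gradφ) (μ := μ) (γ := γ)
    hL hD hD0 hM hM0 hg hW hr
  have hA : 0 ≤ L + μ * ((E + Fintype.card κ * M) * L) := by positivity
  refine ⟨L + μ * ((E + Fintype.card κ * M) * L) + 1, by linarith, fun V y e h t i => ?_⟩
  refine (inner_updateDirection_le hμ hL hφ hg (h.mem_feasibleSet t) (h.mem_feasibleSet (t + 1) i)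
    (S := E + Fintype.card κ * M) ?_).trans ?_
  · exact (sum_max_estimates_le hr hM (h.mem_feasibleSet t) (e t) i).trans (by linarith [hE _ _ _ h t])
  · refine mul_le_mul_of_nonneg_right ?_ (norm_nonneg _)
    linarith [mul_nonneg hA (norm_nonneg (V t))]

lemma IsTrajectory.norm_step_le (h : IsTrajectory G gradφ g gradg μ W γ V y e)
    (hG : ∀ i, Convex ℝ (G i)) (hγ : ∀ t, 0 ≤ γ t) {A : ℝ} (hA : 0 ≤ A)
    (hslope : ∀ t i, ⟪updateDirection gradφ gradg μ (y t) (e t) (V t) i, y (t + 1) i - y t i⟫ ≤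
      A * (1 + ‖V t‖) * ‖y (t + 1) i - y t i‖) (t : ℕ) :
    ‖y (t + 1) - y t‖ ≤ Fintype.card ι * A * (γ t * (1 + ‖V t‖)) := by
  refine (norm_le_sum_norm _).trans ((Finset.sum_le_sum fun i _ =>
    (h.y_succ t i).norm_step_le (hG i) (hγ t) (h.mem_feasibleSet t i) (by positivity)
      (hslope t i)).trans (le_of_eq ?_))
  rw [Finset.sum_const, Finset.card_univ, nsmul_eq_mul]
  ring

lemma IsTrajectory.norm_sub_sq_step_le [Nonempty ι]
    (h : IsTrajectory G gradφ g gradg μ W γ V y e) (hμ : 0 < μ) (hL : 0 ≤ L)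
    (hG : ∀ i, Convex ℝ (G i)) (hD : ∀ i, ∀ x ∈ G i, ∀ z ∈ G i, ‖x - z‖ ≤ D) (hD0 : 0 ≤ D)
    (hφ : ∀ i, IsLipschitzSubgradient (G i) L (φ i) (gradφ i))
    (hg : ∀ i k, IsLipschitzSubgradient (G i) L (g i k) (gradg i k))
    (hr : IsMixingGauge W r ρ K) (hγ : ∀ t, 0 ≤ γ t) {A : ℝ}
    (hslope : ∀ t i, ⟪updateDirection gradφ gradg μ (y t) (e t) (V t) i, y (t + 1) i - y t i⟫ ≤
      A * (1 + ‖V t‖) * ‖y (t + 1) i - y t i‖) {z : Decision n} (hz : z ∈ feasibleSet G) (t : ℕ) :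
    ‖y (t + 1) - z‖ ^ 2 / 2 +
        γ t * (penalizedObjective φ g μ (y t) - penalizedObjective φ g μ z) ≤
      ‖y t - z‖ ^ 2 / 2 + γ t * ⟪V t, y t - z⟫ +
        μ * (L * D) * (γ t * consensusError g r (y t) (e t)) +
        Fintype.card ι * A ^ 2 / 2 * (γ t * (1 + ‖V t‖)) ^ 2 := by
  have h1 : ‖y (t + 1) - z‖ ^ 2 ≤ ‖y t - z‖ ^ 2 +
      2 * γ t * ∑ i, ⟪updateDirection gradφ gradg μ (y t) (e t) (V t) i, y t i - z i⟫ +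
      Fintype.card ι * (γ t ^ 2 * (A * (1 + ‖V t‖)) ^ 2) := by
    rw [PiLp.norm_sq_eq_of_L2, PiLp.norm_sq_eq_of_L2, Finset.mul_sum, ← nsmul_eq_mul,
      ← Finset.card_univ, ← Finset.sum_const, ← Finset.sum_add_distrib,
      ← Finset.sum_add_distrib]
    exact Finset.sum_le_sum fun i _ =>
      (h.y_succ t i).norm_sub_sq_le (hG i) (hγ t) (hz i) (hslope t i)
  have h2 := mul_le_mul_of_nonneg_left
    (sum_inner_updateDirection_le hμ hL hD hD0 hφ hg hr (h.mem_feasibleSet t) hz (e t) (V t)) (hγ t)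
  linarith

/-- Uniform bounds along the trajectories: the increments are controlled by the perturbations, and
the accumulated suboptimality is bounded up to a noise term. -/
lemma exists_trajectory_bound [DecidableEq ι] [Nonempty ι] (hμ : 0 < μ) (hL : 0 ≤ L)
    (hG : ∀ i, Convex ℝ (G i))
    (hD : ∀ i, ∀ x ∈ G i, ∀ z ∈ G i, ‖x - z‖ ≤ D) (hD0 : 0 ≤ D)
    (hM : ∀ i k, ∀ x ∈ G i, |g i k x| ≤ M) (hM0 : 0 ≤ M)
    (hφ : ∀ i, IsLipschitzSubgradient (G i) L (φ i) (gradφ i))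
    (hg : ∀ i k, IsLipschitzSubgradient (G i) L (g i k) (gradg i k))
    (hW : W ∈ doublyStochastic ℝ ι) (hprim : W.IsPrimitive) (hγ : ∀ t, 0 ≤ γ t) :
    ∃ B : ℝ, 0 ≤ B ∧ ∀ V y e, IsTrajectory G gradφ g gradg μ W γ V y e →
      (∀ t, ‖y (t + 1) - y t‖ ≤ B * (γ t * (1 + ‖V t‖))) ∧
      ∀ z ∈ feasibleSet G, ∀ T, ∑ t ∈ Finset.range T,
        γ t * (penalizedObjective φ g μ (y t) - penalizedObjective φ g μ z) ≤
        B + ∑ t ∈ Finset.range T, γ t * ⟪V t, y t - z⟫ +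
          B * ∑ t ∈ Finset.range T, (γ t * (1 + ‖V t‖)) ^ 2 := by
  obtain ⟨r, ρ, K, hr⟩ := exists_isMixingGauge hW hprim
  obtain ⟨E, hE0, hE⟩ := exists_consensusError_le (gradφ := gradφ) (μ := μ) (γ := γ)
    hL hD hD0 hM hM0 hg hW hr
  obtain ⟨A, hA0, hA⟩ := exists_slope_bound (γ := γ) hμ hL hD hD0 hM hM0 hφ hg hW hr
  have hK := hr.const_nonneg
  have hρ1 : 0 < 1 - ρ := sub_pos.2 hr.rate_lt_one
  set N : ℝ := (Fintype.card ι : ℝ) with hN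
  have hN0 : 0 ≤ N := by positivity
  set c : ℝ := Fintype.card κ * (K * (2 * (N * L))) with hc
  have hc0 : 0 ≤ c := by positivity
  set B₁ : ℝ := (N * D) ^ 2 / 2 + μ * (L * D) * (E ^ 2 / (1 - ρ)) with hB₁
  set B₂ : ℝ := N * A ^ 2 / 2 + μ * (L * D) * (1 + (c * (N * A)) ^ 2 / (1 - ρ) ^ 2) with hB₂
  have hB₁0 : 0 ≤ B₁ := by positivity
  have hB₂0 : 0 ≤ B₂ := by positivity
  have hNA : 0 ≤ N * A := by positivity
  refine ⟨N * A + B₁ + B₂, by positivity, fun V y e h => ?_⟩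
  have hinc := h.norm_step_le hG hγ hA0 (hA V y e h)
  have hs0 : ∀ t, 0 ≤ γ t * (1 + ‖V t‖) := fun t => mul_nonneg (hγ t) (by positivity)
  refine ⟨fun t => (hinc t).trans (mul_le_mul_of_nonneg_right (by linarith) (hs0 t)),
    fun z hz T => ?_⟩
  have htele : ∀ T, ‖y T - z‖ ^ 2 / 2 + ∑ t ∈ Finset.range T,
      γ t * (penalizedObjective φ g μ (y t) - penalizedObjective φ g μ z) ≤
      ‖y 0 - z‖ ^ 2 / 2 + ∑ t ∈ Finset.range T, γ t * ⟪V t, y t - z⟫ +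
        μ * (L * D) * ∑ t ∈ Finset.range T, γ t * consensusError g r (y t) (e t) +
        N * A ^ 2 / 2 * ∑ t ∈ Finset.range T, (γ t * (1 + ‖V t‖)) ^ 2 := by
    intro T
    induction T with
    | zero => simp
    | succ T ih =>
      simp only [Finset.sum_range_succ]
      rw [mul_add (μ * (L * D)), mul_add (N * A ^ 2 / 2)]
      linarith [h.norm_sub_sq_step_le hμ hL hG hD hD0 hφ hg hr hγ (hA V y e h) hz T]
  have hεsum : ∑ t ∈ Finset.range T, γ t * consensusError g r (y t) (e t) ≤ E ^ 2 / (1 - ρ) +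
      (1 + (c * (N * A)) ^ 2 / (1 - ρ) ^ 2) *
        ∑ t ∈ Finset.range T, (γ t * (1 + ‖V t‖)) ^ 2 := by
    refine (sum_mul_le_of_contraction (ε := fun t => consensusError g r (y t) (e t))
      hr.rate_nonneg hr.rate_lt_one (fun t => hr.consensusError_nonneg _ _)
      (q := fun t => c * (N * A * (γ t * (1 + ‖V t‖))))
      (fun t => (h.consensusError_succ_le hW hr hL hg t).trans
        (add_le_add_right (mul_le_mul_of_nonneg_left (hinc t) hc0) _)) T).trans ?_
    refine add_le_add (div_le_div_of_nonneg_right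
      (pow_le_pow_left₀ (hr.consensusError_nonneg _ _) (hE V y e h 0) 2) hρ1.le) ?_
    rw [Finset.mul_sum]
    refine Finset.sum_le_sum fun t _ => ?_
    rw [add_mul, one_mul]
    refine add_le_add (pow_le_pow_left₀ (hγ t) ?_ 2) (le_of_eq (by ring))
    linarith [mul_nonneg (hγ t) (norm_nonneg (V t))]
  set S : ℝ := ∑ t ∈ Finset.range T, (γ t * (1 + ‖V t‖)) ^ 2 with hS
  have hS0 : 0 ≤ S := Finset.sum_nonneg fun t _ => sq_nonneg _
  have h0 : ‖y 0 - z‖ ^ 2 ≤ (N * D) ^ 2 :=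
    pow_le_pow_left₀ (norm_nonneg _) (norm_sub_le_of_mem hD h.y_zero hz) 2
  have hμLD : 0 ≤ μ * (L * D) := by positivity
  have h1 := mul_le_mul_of_nonneg_left hεsum hμLD
  have h2 : 0 ≤ (N * A + B₁) * S := by positivity
  have h3 : B₂ * S = N * A ^ 2 / 2 * S +
      μ * (L * D) * ((1 + (c * (N * A)) ^ 2 / (1 - ρ) ^ 2) * S) := by
    rw [hB₂]
    ring
  have h4 := htele T
  have h5 : 0 ≤ ‖y T - z‖ ^ 2 := sq_nonneg _
  rw [add_mul (N * A + B₁), h3]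
  rw [mul_add] at h1
  linarith

end Pathwise

end PenaltyConsensus

namespace PenaltyConsensus

open Filter Topology RealInnerProductSpace MeasureTheory ProbabilityTheory

/-! ### Regularity of the penalized objective -/

section Objective

variable {ι κ : Type*} {n : ι → ℕ}
  {G : ∀ i, Set (EuclideanSpace ℝ (Fin (n i)))}
  {φ : ∀ i, EuclideanSpace ℝ (Fin (n i)) → ℝ}
  {gradφ : ∀ i, EuclideanSpace ℝ (Fin (n i)) → EuclideanSpace ℝ (Fin (n i))}
  {g : ∀ i, κ → EuclideanSpace ℝ (Fin (n i)) → ℝ}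
  {gradg : ∀ i, κ → EuclideanSpace ℝ (Fin (n i)) → EuclideanSpace ℝ (Fin (n i))}
  {μ L M : ℝ}

lemma feasibleSet_eq_image : feasibleSet G = WithLp.toLp 2 '' Set.univ.pi G := by
  ext x
  constructor
  · exact fun hx => ⟨x.ofLp, fun i _ => hx i, rfl⟩
  · rintro ⟨z, hz, rfl⟩ i
    exact hz i trivial

lemma isCompact_feasibleSet (hG : ∀ i, IsCompact (G i)) : IsCompact (feasibleSet G) := by
  rw [feasibleSet_eq_image]
  exact (isCompact_univ_pi hG).image (PiLp.continuous_toLp 2 _)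

lemma feasibleSet_nonempty (hG : ∀ i, (G i).Nonempty) : (feasibleSet G).Nonempty := by
  rw [feasibleSet_eq_image]
  exact (Set.univ_pi_nonempty_iff.2 hG).image _

lemma exists_penalizedObjective_lipschitz [Fintype ι] [Nonempty ι] [Fintype κ] (hμ : 0 < μ)
    (hL : 0 ≤ L) (hM : ∀ i k, ∀ x ∈ G i, |g i k x| ≤ M) (hM0 : 0 ≤ M)
    (hφ : ∀ i, IsLipschitzSubgradient (G i) L (φ i) (gradφ i))
    (hg : ∀ i k, IsLipschitzSubgradient (G i) L (g i k) (gradg i k)) :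
    ∃ C : NNReal, LipschitzOnWith C (penalizedObjective φ g μ) (feasibleSet G) := by
  have hN : (0 : ℝ) < Fintype.card ι := by exact_mod_cast Fintype.card_pos
  set N : ℝ := (Fintype.card ι : ℝ)
  have hC : 0 ≤ N * L + μ / (2 * N) * (Fintype.card κ * (N * L * (2 * (N * M)))) := by positivity
  refine ⟨NNReal.mk _ hC, LipschitzOnWith.of_dist_le_mul fun x hx z hz => ?_⟩
  rw [Real.dist_eq, dist_eq_norm, NNReal.coe_mk]
  have h1 : |∑ i, φ i (x i) - ∑ i, φ i (z i)| ≤ N * L * ‖x - z‖ := by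
    rw [← Finset.sum_sub_distrib]
    exact (Finset.abs_sum_le_sum_abs _ _).trans
      (sum_abs_sub_le (κ := Unit) (g := fun i _ => φ i) (fun i _ => hφ i) hL hz hx ())
  have habs : ∀ w ∈ feasibleSet G, ∀ k, max 0 (globalConstraint g k w) ≤ N * M := by
    intro w hw k
    have h := (le_abs_self _).trans (abs_globalConstraint_div_card_le hM hw k)
    rw [div_le_iff₀ hN, mul_comm] at h
    exact max_le (by positivity) h
  have h2 : ∀ k, |max 0 (globalConstraint g k x) ^ 2 - max 0 (globalConstraint g k z) ^ 2| ≤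
      N * L * (2 * (N * M)) * ‖x - z‖ := by
    intro k
    have h3 : |max 0 (globalConstraint g k x) - max 0 (globalConstraint g k z)| ≤
        N * L * ‖x - z‖ := by
      rw [max_comm 0, max_comm 0]
      refine (abs_max_sub_max_le_abs _ _ _).trans ?_
      rw [globalConstraint, globalConstraint, ← Finset.sum_sub_distrib]
      exact (Finset.abs_sum_le_sum_abs _ _).trans (sum_abs_sub_le hg hL hz hx k)
    have h4 : |max 0 (globalConstraint g k x) + max 0 (globalConstraint g k z)| ≤
        2 * (N * M) := by
      rw [abs_of_nonneg (add_nonneg (le_max_left _ _) (le_max_left _ _))]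
      linarith [habs x hx k, habs z hz k]
    rw [sq_sub_sq, abs_mul]
    calc _ ≤ 2 * (N * M) * (N * L * ‖x - z‖) :=
          mul_le_mul h4 h3 (abs_nonneg _) (by positivity)
      _ = _ := by ring
  have h3 : |∑ k, max 0 (globalConstraint g k x) ^ 2 - ∑ k, max 0 (globalConstraint g k z) ^ 2| ≤
      Fintype.card κ * (N * L * (2 * (N * M)) * ‖x - z‖) := by
    rw [← Finset.sum_sub_distrib, ← nsmul_eq_mul]
    exact (Finset.abs_sum_le_sum_abs _ _).trans (Finset.sum_le_card_nsmul _ _ _ fun k _ => h2 k)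
  have h4 : 0 ≤ μ / (2 * N) := by positivity
  have h5 : penalizedObjective φ g μ x - penalizedObjective φ g μ z =
      (∑ i, φ i (x i) - ∑ i, φ i (z i)) + μ / (2 * N) *
        (∑ k, max 0 (globalConstraint g k x) ^ 2 - ∑ k, max 0 (globalConstraint g k z) ^ 2) := by
    simp only [penalizedObjective]
    ring
  rw [h5]
  refine (abs_add_le _ _).trans ?_
  rw [abs_mul, abs_of_nonneg h4]
  calc _ ≤ N * L * ‖x - z‖ +
        μ / (2 * N) * (Fintype.card κ * (N * L * (2 * (N * M)) * ‖x - z‖)) :=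
        add_le_add h1 (mul_le_mul_of_nonneg_left h3 h4)
    _ = _ := by ring

end Objective

/-- A minimizing sequence of a continuous function in a compact set approaches the minimizers. -/
lemma tendsto_infDist_minimizers {X : Type*} [PseudoMetricSpace X] {F : Set X}
    (hF : IsCompact F) {f : X → ℝ} (hf : ContinuousOn f F) {z : X}
    (hmin : ∀ x ∈ F, f z ≤ f x) {y : ℕ → X} (hy : ∀ t, y t ∈ F)
    (hlim : Tendsto (fun t => f (y t) - f z) atTop (𝓝 0)) :
    Tendsto (fun t => Metric.infDist (y t) {x | x ∈ F ∧ ∀ w ∈ F, f x ≤ f w}) atTop (𝓝 0) := by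
  set S := {x | x ∈ F ∧ ∀ w ∈ F, f x ≤ f w} with hS
  rw [Metric.tendsto_atTop']
  intro ε hε
  simp only [Real.dist_eq, sub_zero, abs_of_nonneg Metric.infDist_nonneg]
  have hK : IsCompact (F ∩ {x | ε ≤ Metric.infDist x S}) :=
    hF.inter_right (isClosed_le continuous_const (Metric.continuous_infDist_pt S))
  rcases (F ∩ {x | ε ≤ Metric.infDist x S}).eq_empty_or_nonempty with hemp | hne
  · refine ⟨0, fun t _ => lt_of_not_ge fun hge => ?_⟩
    have : y t ∈ F ∩ {x | ε ≤ Metric.infDist x S} := ⟨hy t, hge⟩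
    rw [hemp] at this
    exact this
  · obtain ⟨x₀, hx₀, hx₀min⟩ := hK.exists_isMinOn hne (hf.mono Set.inter_subset_left)
    have hlt : f z < f x₀ := by
      refine lt_of_not_ge fun hle => ?_
      have hmem : x₀ ∈ S := ⟨hx₀.1, fun w hw => hle.trans (hmin w hw)⟩
      have := hx₀.2
      rw [Set.mem_ofPred_eq, Metric.infDist_zero_of_mem hmem] at this
      linarith
    obtain ⟨T, hT⟩ := eventually_atTop.1 (hlim.eventually_lt_const (sub_pos.2 hlt))
    refine ⟨T, fun t ht => lt_of_not_ge fun hge => ?_⟩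
    have h1 : f x₀ ≤ f (y t) := hx₀min ⟨hy t, hge⟩
    linarith [hT t ht.le]

/-! ### Perturbations with a given conditional distribution -/

section Noise

variable {Ω : Type*} [MeasurableSpace Ω] {P : Measure Ω}

lemma ae_summable_of_tsum_lintegral_ne_top {X : ℕ → Ω → ℝ} (hX : ∀ t, Measurable (X t))
    (hX0 : ∀ t ω, 0 ≤ X t ω) (hsum : ∑' t, ∫⁻ ω, ENNReal.ofReal (X t ω) ∂P ≠ ⊤) :
    ∀ᵐ ω ∂P, Summable fun t => X t ω := by
  rw [← lintegral_tsum fun t => (hX t).ennreal_ofReal.aemeasurable] at hsum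
  filter_upwards [ae_lt_top' (AEMeasurable.tsum
    fun t => (hX t).ennreal_ofReal.aemeasurable) hsum] with ω hω
  simpa [ENNReal.toReal_ofReal (hX0 _ _)] using ENNReal.summable_toReal hω.ne

variable {E : Type*} [MeasurableSpace E]

lemma lintegral_mul_le_of_hasCondDistrib {ν : Kernel E E} [IsMarkovKernel ν]
    [IsProbabilityMeasure P] {V y : Ω → E} {F : Set E} (h : HasCondDistrib V y ν P)
    (hV : Measurable V) (hy : Measurable y) (hyF : ∀ ω, y ω ∈ F) {a w : E → ENNReal}
    (ha : Measurable a) (hw : Measurable w) {C : ENNReal} (hC : ∀ x ∈ F, ∫⁻ v, w v ∂(ν x) ≤ C) :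
    ∫⁻ ω, a (y ω) * w (V ω) ∂P ≤ C * ∫⁻ ω, a (y ω) ∂P := by
  have hm : Measurable fun p : E × E => a p.1 * w p.2 :=
    (ha.comp measurable_fst).mul (hw.comp measurable_snd)
  have h1 : ∫⁻ ω, a (y ω) * w (V ω) ∂P = ∫⁻ p, a p.1 * w p.2 ∂(P.map y ⊗ₘ ν) := by
    rw [← h.map_eq, lintegral_map hm (hy.prodMk hV)]
  rw [h1, Measure.lintegral_compProd hm, lintegral_map hm.lintegral_kernel_prod_right' hy,
    ← lintegral_const_mul C (show Measurable fun ω => a (y ω) from ha.comp hy)]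
  refine lintegral_mono fun ω => ?_
  dsimp only
  rw [lintegral_const_mul _ hw, mul_comm]
  exact mul_le_mul_left (hC _ (hyF ω)) _

variable [NormedAddCommGroup E] [BorelSpace E]

lemma lintegral_one_add_norm_sq_le {ν : Measure E} [IsProbabilityMeasure ν] {C : ℝ}
    (h : ∫⁻ v, ‖v‖ₑ ^ 2 ∂ν ≤ ENNReal.ofReal C) :
    ∫⁻ v, ENNReal.ofReal ((1 + ‖v‖) ^ 2) ∂ν ≤ ENNReal.ofReal (2 + 2 * max C 0) := by
  have hle : ∀ v : E, ENNReal.ofReal ((1 + ‖v‖) ^ 2) ≤ 2 + 2 * ‖v‖ₑ ^ 2 := by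
    intro v
    have h1 : (2 : ENNReal) + 2 * ‖v‖ₑ ^ 2 = ENNReal.ofReal (2 + 2 * ‖v‖ ^ 2) := by
      rw [ENNReal.ofReal_add (by norm_num) (by positivity), ENNReal.ofReal_mul (by norm_num),
        ENNReal.ofReal_pow (norm_nonneg _), ofReal_norm]
      simp
    rw [h1]
    exact ENNReal.ofReal_le_ofReal (by nlinarith [sq_nonneg (1 - ‖v‖)])
  refine (lintegral_mono hle).trans ?_
  rw [lintegral_add_left measurable_const, lintegral_const, measure_univ, mul_one,
    lintegral_const_mul _ (by fun_prop), ENNReal.ofReal_add (by norm_num) (by positivity),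
    ENNReal.ofReal_mul (by norm_num)]
  simp only [ENNReal.ofReal_ofNat]
  gcongr
  exact h.trans (ENNReal.ofReal_le_ofReal (le_max_left _ _))

variable [InnerProductSpace ℝ E] [SecondCountableTopology E] {ν : Kernel E E} [IsMarkovKernel ν]
  {F : Set E}

lemma integral_inner_eq_zero_of_hasCondDistrib [CompleteSpace E] [IsProbabilityMeasure P] {V y : Ω → E}
    (h : HasCondDistrib V y ν P) (hV : Measurable V) (hy : Measurable y) (hyF : ∀ ω, y ω ∈ F)
    (hmean : ∀ x ∈ F, ∫ v, v ∂(ν x) = 0) (hintν : ∀ x ∈ F, Integrable (fun v => v) (ν x)) (z : E)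
    (hint : Integrable (fun ω => ⟪V ω, y ω - z⟫) P) : ∫ ω, ⟪V ω, y ω - z⟫ ∂P = 0 := by
  have hm : StronglyMeasurable fun p : E × E => ⟪p.2, p.1 - z⟫ :=
    (continuous_snd.inner (continuous_fst.sub continuous_const)).stronglyMeasurable
  have h0 : Integrable (fun p : E × E => ⟪p.2, p.1 - z⟫) (P.map y ⊗ₘ ν) := by
    rw [← h.map_eq, integrable_map_measure hm.aestronglyMeasurable (hy.prodMk hV).aemeasurable]
    exact hint
  have h1 : ∫ ω, ⟪V ω, y ω - z⟫ ∂P = ∫ p, ⟪p.2, p.1 - z⟫ ∂(P.map y ⊗ₘ ν) := by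
    rw [← h.map_eq, integral_map (hy.prodMk hV).aemeasurable hm.aestronglyMeasurable]
  rw [h1, Measure.integral_compProd h0]
  have h2 : StronglyMeasurable fun x => ∫ v, ⟪v, x - z⟫ ∂(ν x) := hm.integral_kernel_prod_right'
  rw [integral_map hy.aemeasurable h2.aestronglyMeasurable]
  refine integral_eq_zero_of_ae (ae_of_all _ fun ω => ?_)
  simp only [Pi.zero_apply]
  simp_rw [real_inner_comm (y ω - z)]
  rw [integral_inner (hintν _ (hyF ω)), hmean _ (hyF ω), inner_zero_right]

/-- Almost sure convergence of a nonnegative function along a process which is driven by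
perturbations that are centred given the current state, if it has a negative drift on average and
moves by at most a multiple of the step sizes and the perturbations. -/
lemma ae_tendsto_zero_of_drift [CompleteSpace E] [IsProbabilityMeasure P] {V y : ℕ → Ω → E}
    (hV : ∀ t, Measurable (V t)) (hy : ∀ t, Measurable (y t)) (hyF : ∀ t ω, y t ω ∈ F)
    (hcond : ∀ t, HasCondDistrib (V t) (y t) ν P) (hmean : ∀ x ∈ F, ∫ v, v ∂(ν x) = 0)
    {C : ℝ} (hC : ∀ x ∈ F, ∫⁻ v, ‖v‖ₑ ^ 2 ∂(ν x) ≤ ENNReal.ofReal C)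
    {γ : ℕ → ℝ} (hγ : ∀ t, 0 ≤ γ t)
    (hγ_sum : ¬ Summable γ) (hγ_sq : Summable fun t => γ t ^ 2)
    {f : E → ℝ} (hf : Measurable f) (hf0 : ∀ x, 0 ≤ f x) {M : ℝ} (hfM : ∀ x, f x ≤ M)
    {z : E} {D : ℝ} (hD : ∀ t ω, ‖y t ω - z‖ ≤ D) {B L : ℝ} (hB : 0 ≤ B)
    (hdrift : ∀ ω T, ∑ t ∈ Finset.range T, γ t * f (y t ω) ≤
      B + ∑ t ∈ Finset.range T, γ t * ⟪V t ω, y t ω - z⟫ +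
        B * ∑ t ∈ Finset.range T, (γ t * (1 + ‖V t ω‖)) ^ 2)
    (hstep : ∀ ω t, f (y (t + 1) ω) ≤ f (y t ω) + L * (γ t * (1 + ‖V t ω‖))) :
    ∀ᵐ ω ∂P, Tendsto (fun t => f (y t ω)) atTop (𝓝 0) := by
  set C₂ : ℝ := 2 + 2 * max C 0 with hC₂
  have hC₂0 : 0 ≤ C₂ := by positivity
  have hνsq : ∀ x ∈ F, ∫⁻ v, ENNReal.ofReal ((1 + ‖v‖) ^ 2) ∂(ν x) ≤ ENNReal.ofReal C₂ :=
    fun x hx => lintegral_one_add_norm_sq_le (hC x hx)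
  have hle_sq : ∀ v : E, 1 + ‖v‖ ≤ (1 + ‖v‖) ^ 2 := fun v => by nlinarith [norm_nonneg v]
  have hνone : ∀ x ∈ F, ∫⁻ v, ENNReal.ofReal (1 + ‖v‖) ∂(ν x) ≤ ENNReal.ofReal C₂ := fun x hx =>
    (lintegral_mono fun v => ENNReal.ofReal_le_ofReal (hle_sq v)).trans (hνsq x hx)
  have hνint : ∀ x ∈ F, Integrable (fun v => v) (ν x) := by
    intro x hx
    refine ⟨measurable_id.aestronglyMeasurable, ?_⟩
    refine lt_of_le_of_lt (lintegral_mono fun v => ?_) ((hνone x hx).trans_lt ENNReal.ofReal_lt_top)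
    rw [← ofReal_norm]
    exact ENNReal.ofReal_le_ofReal (by linarith)
  have hVsq : ∀ t, ∫⁻ ω, ENNReal.ofReal ((1 + ‖V t ω‖) ^ 2) ∂P ≤ ENNReal.ofReal C₂ := by
    intro t
    simpa using lintegral_mul_le_of_hasCondDistrib (hcond t) (hV t) (hy t) (hyF t)
      (measurable_const (a := (1 : ENNReal)))
      (w := fun v => ENNReal.ofReal ((1 + ‖v‖) ^ 2)) (by fun_prop) hνsq
  have hVsq_int : ∀ t, Integrable (fun ω => (1 + ‖V t ω‖) ^ 2) P := by
    intro t
    have hm : Measurable fun ω => (1 + ‖V t ω‖) ^ 2 := ((hV t).norm.const_add 1).pow_const 2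
    refine ⟨hm.aestronglyMeasurable, ?_⟩
    rw [hasFiniteIntegral_iff_ofReal (ae_of_all _ fun ω => sq_nonneg _)]
    exact (hVsq t).trans_lt ENNReal.ofReal_lt_top
  have hVsq_le : ∀ t, ∫ ω, (1 + ‖V t ω‖) ^ 2 ∂P ≤ C₂ := by
    intro t
    rw [integral_eq_lintegral_of_nonneg_ae (ae_of_all _ fun ω => sq_nonneg _)
      (hVsq_int t).aestronglyMeasurable]
    exact ENNReal.toReal_le_of_le_ofReal hC₂0 (hVsq t)
  have hinner_int : ∀ t, Integrable (fun ω => ⟪V t ω, y t ω - z⟫) P := by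
    intro t
    refine ((hVsq_int t).const_mul D).mono'
      ((hV t).inner ((hy t).sub_const z)).aestronglyMeasurable (ae_of_all _ fun ω => ?_)
    refine (norm_inner_le_norm _ _).trans ?_
    rw [mul_comm]
    exact mul_le_mul (hD t ω) (by linarith [hle_sq (V t ω)]) (norm_nonneg _)
      ((norm_nonneg _).trans (hD t ω))
  have hf_int : ∀ t, Integrable (fun ω => f (y t ω)) P := fun t =>
    (integrable_const M).mono' (hf.comp (hy t)).aestronglyMeasurable (ae_of_all _ fun ω => by
      rw [Real.norm_of_nonneg (hf0 _)]
      exact hfM _)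
  have hf_sum : Summable fun t => γ t * ∫ ω, f (y t ω) ∂P := by
    refine summable_of_sum_range_le (c := B + B * (C₂ * ∑' t, γ t ^ 2))
      (fun t => mul_nonneg (hγ t) (integral_nonneg fun ω => hf0 _)) fun T => ?_
    have hi1 : Integrable (fun ω => ∑ t ∈ Finset.range T, γ t * f (y t ω)) P :=
      integrable_finsetSum _ fun t _ => (hf_int t).const_mul _
    have hi2 : Integrable (fun ω => ∑ t ∈ Finset.range T, γ t * ⟪V t ω, y t ω - z⟫) P :=
      integrable_finsetSum _ fun t _ => (hinner_int t).const_mul _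
    have hi3 : Integrable (fun ω => ∑ t ∈ Finset.range T, (γ t * (1 + ‖V t ω‖)) ^ 2) P := by
      simp_rw [mul_pow]
      exact integrable_finsetSum _ fun t _ => (hVsq_int t).const_mul _
    have hi4 : Integrable
        (fun ω => B + ∑ t ∈ Finset.range T, γ t * ⟪V t ω, y t ω - z⟫) P :=
      (integrable_const B).add hi2
    have h1 := integral_mono hi1 (hi4.add (hi3.const_mul B)) fun ω => hdrift ω T
    simp only [Pi.add_apply] at h1
    rw [integral_add hi4 (hi3.const_mul B), integral_const_mul,
      integral_add (integrable_const B) hi2, integral_const, probReal_univ, one_smul,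
      integral_finsetSum _ fun t _ => (hf_int t).const_mul _,
      integral_finsetSum _ fun t _ => (hinner_int t).const_mul _] at h1
    simp_rw [mul_pow] at h1
    rw [integral_finsetSum _ fun t _ => (hVsq_int t).const_mul _] at h1
    simp_rw [integral_const_mul, fun t => integral_inner_eq_zero_of_hasCondDistrib (hcond t) (hV t)
      (hy t) (hyF t) hmean hνint z (hinner_int t), mul_zero, Finset.sum_const_zero, add_zero] at h1
    refine h1.trans (add_le_add_right (mul_le_mul_of_nonneg_left ?_ hB) _)
    calc ∑ t ∈ Finset.range T, γ t ^ 2 * ∫ ω, (1 + ‖V t ω‖) ^ 2 ∂P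
        ≤ ∑ t ∈ Finset.range T, γ t ^ 2 * C₂ :=
          Finset.sum_le_sum fun t _ => mul_le_mul_of_nonneg_left (hVsq_le t) (sq_nonneg _)
      _ = C₂ * ∑ t ∈ Finset.range T, γ t ^ 2 := by rw [← Finset.sum_mul, mul_comm]
      _ ≤ C₂ * ∑' t, γ t ^ 2 := mul_le_mul_of_nonneg_left
          (hγ_sq.sum_le_tsum _ fun t _ => sq_nonneg _) hC₂0
  have hprod : ∀ᵐ ω ∂P, Summable fun t => γ t * (1 + ‖V t ω‖) * f (y t ω) := by
    refine ae_summable_of_tsum_lintegral_ne_top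
      (fun t => (((hV t).norm.const_add 1).const_mul _).mul (hf.comp (hy t)))
      (fun t ω => mul_nonneg (mul_nonneg (hγ t) (by positivity)) (hf0 _)) ?_
    refine ne_top_of_le_ne_top (hf_sum.mul_left C₂).tsum_ofReal_ne_top
      (ENNReal.tsum_le_tsum fun t => ?_)
    have h1 : ∀ ω, ENNReal.ofReal (γ t * (1 + ‖V t ω‖) * f (y t ω)) =
        ENNReal.ofReal (γ t) *
          (ENNReal.ofReal (f (y t ω)) * ENNReal.ofReal (1 + ‖V t ω‖)) := by
      intro ω
      rw [← ENNReal.ofReal_mul (hf0 _), ← ENNReal.ofReal_mul (hγ t)]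
      congr 1
      ring
    simp_rw [h1]
    rw [lintegral_const_mul _ (by
        exact (hf.comp (hy t)).ennreal_ofReal.mul ((hV t).norm.const_add 1).ennreal_ofReal),
      show C₂ * (γ t * ∫ ω, f (y t ω) ∂P) = γ t * (C₂ * ∫ ω, f (y t ω) ∂P) by ring,
      ENNReal.ofReal_mul (hγ t), ENNReal.ofReal_mul hC₂0,
      ofReal_integral_eq_lintegral_ofReal (hf_int t) (ae_of_all _ fun ω => hf0 _)]
    refine mul_le_mul_right (lintegral_mul_le_of_hasCondDistrib (hcond t) (hV t) (hy t) (hyF t)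
      (a := fun x => ENNReal.ofReal (f x)) hf.ennreal_ofReal
      (w := fun v => ENNReal.ofReal (1 + ‖v‖)) (by fun_prop) hνone) _
  have hsq : ∀ᵐ ω ∂P, Summable fun t => (γ t * (1 + ‖V t ω‖)) ^ 2 := by
    refine ae_summable_of_tsum_lintegral_ne_top
      (fun t => (((hV t).norm.const_add 1).const_mul _).pow_const 2) (fun t ω => sq_nonneg _) ?_
    refine ne_top_of_le_ne_top (hγ_sq.mul_right C₂).tsum_ofReal_ne_top
      (ENNReal.tsum_le_tsum fun t => ?_)
    simp_rw [mul_pow, ENNReal.ofReal_mul (sq_nonneg (γ t))]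
    rw [lintegral_const_mul _ (((hV t).norm.const_add 1).pow_const 2).ennreal_ofReal]
    exact mul_le_mul_right (hVsq t) _
  filter_upwards [hprod, hsq] with ω h1 h2
  refine tendsto_zero_of_summable_mul (s := fun t => γ t * (1 + ‖V t ω‖)) (fun t => hf0 _)
    (fun t => mul_nonneg (hγ t) (by positivity)) (hstep ω) h1 h2 fun hsum => hγ_sum ?_
  refine Summable.of_nonneg_of_le hγ (fun t => ?_) hsum
  linarith [mul_nonneg (hγ t) (norm_nonneg (V t ω))]

end Noise

end PenaltyConsensus

namespace PenaltyConsensus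

/-- Finitely many constants have a common nonnegative upper bound. -/
lemma exists_common_bound {α : Type*} [Finite α] (c : α → ℝ) : ∃ C, 0 ≤ C ∧ ∀ a, c a ≤ C := by
  obtain ⟨C, hC⟩ := (Set.finite_range c).bddAbove
  exact ⟨max C 0, le_max_right _ _, fun a => (hC ⟨a, rfl⟩).trans (le_max_left _ _)⟩

end PenaltyConsensus

open MeasureTheory ProbabilityTheory Filter Topology PenaltyConsensus in
theorem theorem1
    {ι κ : Type*} [Fintype ι] [DecidableEq ι] [Nonempty ι] [Fintype κ] {n : ι → ℕ}
    -- local constraint sets: nonempty, compact and convex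
    (G : ∀ i, Set (EuclideanSpace ℝ (Fin (n i))))
    (hG_nonempty : ∀ i, (G i).Nonempty)
    (hG_compact : ∀ i, IsCompact (G i))
    (hG_convex : ∀ i, Convex ℝ (G i))
    -- local objective functions: convex and Lipschitz on `G i`, with gradient `gradφ i`
    (φ : ∀ i, EuclideanSpace ℝ (Fin (n i)) → ℝ)
    (gradφ : ∀ i, EuclideanSpace ℝ (Fin (n i)) → EuclideanSpace ℝ (Fin (n i)))
    (hφ_convex : ∀ i, ConvexOn ℝ (G i) (φ i))
    (hφ_lipschitz : ∀ i, ∃ L, LipschitzOnWith L (φ i) (G i))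
    (hφ_grad : ∀ i, ∀ x ∈ G i, HasGradientWithinAt (φ i) (gradφ i x) (G i) x)
    -- constraint functions: convex and Lipschitz on `G i`, with gradient `gradg i k`
    (g : ∀ i, κ → EuclideanSpace ℝ (Fin (n i)) → ℝ)
    (gradg : ∀ i, κ → EuclideanSpace ℝ (Fin (n i)) → EuclideanSpace ℝ (Fin (n i)))
    (hg_convex : ∀ i k, ConvexOn ℝ (G i) (g i k))
    (hg_lipschitz : ∀ i k, ∃ L, LipschitzOnWith L (g i k) (G i))
    (hg_grad : ∀ i k, ∀ x ∈ G i, HasGradientWithinAt (g i k) (gradg i k x) (G i) x)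
    -- penalty parameter
    (μ : ℝ) (hμ : 0 < μ)
    -- weight matrix: doubly stochastic, strongly connected and aperiodic
    (W : Matrix ι ι ℝ)
    (hW_stochastic : W ∈ doublyStochastic ℝ ι)
    (hW_connected : W.IsIrreducible)
    (hW_aperiodic : W.IsPrimitive)
    -- step sizes
    (γ : ℕ → ℝ) (hγ_nonneg : ∀ t, 0 ≤ γ t)
    (hγ_sum : Tendsto (fun T => ∑ t ∈ Finset.range T, γ t) atTop atTop)
    (hγ_sq : Summable fun t => γ t ^ 2)
    -- random decisions `y`, estimates `e` and perturbations `V` following the algorithm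
    {Ω : Type*} [MeasurableSpace Ω] (P : Measure Ω) [IsProbabilityMeasure P]
    (V y : ℕ → Ω → Decision n) (e : ℕ → Ω → ι → κ → ℝ)
    (hV_meas : ∀ t, Measurable (V t)) (hy_meas : ∀ t, Measurable (y t))
    (h_run : ∀ ω, IsTrajectory G gradφ g gradg μ W γ
      (fun t => V t ω) (fun t => y t ω) (fun t => e t ω))
    -- given `y(t) = x`, the perturbation `V(t)` has law `ν x`, centred, with bounded second moment
    (ν : Kernel (Decision n) (Decision n)) [IsMarkovKernel ν]
    (hν_cond : ∀ t, HasCondDistrib (V t) (y t) ν P)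
    (hν_mean : ∀ x ∈ feasibleSet G, ∫ v, v ∂(ν x) = 0)
    (hν_second : ∃ C : ℝ, ∀ x ∈ feasibleSet G, ∫⁻ v, ‖v‖ₑ ^ 2 ∂(ν x) ≤ ENNReal.ofReal C) :
    (optimalSet G φ g μ).Nonempty ∧
      ∀ᵐ ω ∂P, Tendsto (fun t => Metric.infDist (y t ω) (optimalSet G φ g μ)) atTop (𝓝 0) := by
  choose Lφ hLφ using hφ_lipschitz
  choose Lg hLg using hg_lipschitz
  obtain ⟨L₁, hL₁0, hL₁⟩ := exists_common_bound fun i => (Lφ i : ℝ)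
  obtain ⟨L₂, hL₂0, hL₂⟩ := exists_common_bound fun p : ι × κ => (Lg p.1 p.2 : ℝ)
  set L : ℝ := max L₁ L₂ with hLdef
  have hL : 0 ≤ L := hL₁0.trans (le_max_left _ _)
  have hφ : ∀ i, IsLipschitzSubgradient (G i) L (φ i) (gradφ i) := fun i =>
    (isLipschitzSubgradient_of_hasGradientWithinAt (hφ_convex i) (hLφ i) (hφ_grad i)).mono
      ((hL₁ i).trans (le_max_left _ _))
  have hg : ∀ i k, IsLipschitzSubgradient (G i) L (g i k) (gradg i k) := fun i k =>
    (isLipschitzSubgradient_of_hasGradientWithinAt (hg_convex i k) (hLg i k) (hg_grad i k)).mono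
      ((hL₂ (i, k)).trans (le_max_right _ _))
  obtain ⟨D, hD0, hD'⟩ := exists_common_bound fun i => Metric.diam (G i)
  have hD : ∀ i, ∀ x ∈ G i, ∀ z ∈ G i, ‖x - z‖ ≤ D := fun i x hx z hz => by
    rw [← dist_eq_norm]
    exact (Metric.dist_le_diam_of_mem (hG_compact i).isBounded hx hz).trans (hD' i)
  have hbdd : ∀ p : ι × κ, ∃ M, ∀ x ∈ G p.1, |g p.1 p.2 x| ≤ M := fun p => by
    obtain ⟨M, hM⟩ := (hG_compact p.1).exists_bound_of_continuousOn (hLg p.1 p.2).continuousOn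
    exact ⟨M, hM⟩
  choose M' hM' using hbdd
  obtain ⟨M, hM0, hMle⟩ := exists_common_bound M'
  have hM : ∀ i k, ∀ x ∈ G i, |g i k x| ≤ M := fun i k x hx =>
    (hM' (i, k) x hx).trans (hMle (i, k))
  obtain ⟨CΦ, hΦ⟩ := exists_penalizedObjective_lipschitz hμ hL hM hM0 hφ hg
  have hF := isCompact_feasibleSet hG_compact
  obtain ⟨z, hz, hzmin⟩ := hF.exists_isMinOn (feasibleSet_nonempty hG_nonempty) hΦ.continuousOn
  have hzmin' : ∀ x ∈ feasibleSet G, penalizedObjective φ g μ z ≤ penalizedObjective φ g μ x :=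
    fun x hx => hzmin hx
  refine ⟨⟨z, hz, hzmin'⟩, ?_⟩
  obtain ⟨B, hB0, hB⟩ := exists_trajectory_bound hμ hL hG_convex hD hD0 hM hM0 hφ hg
    hW_stochastic hW_aperiodic hγ_nonneg
  have hmem : ∀ t ω, y t ω ∈ feasibleSet G := fun t ω => (h_run ω).mem_feasibleSet t
  obtain ⟨C, hC⟩ := hν_second
  have hcont : ContinuousOn (fun x => penalizedObjective φ g μ x - penalizedObjective φ g μ z)
      (feasibleSet G) := hΦ.continuousOn.sub continuousOn_const
  obtain ⟨M₂, hM₂⟩ := hF.exists_bound_of_continuousOn hcont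
  classical
  set f : Decision n → ℝ := (feasibleSet G).indicator
    fun x => penalizedObjective φ g μ x - penalizedObjective φ g μ z with hf
  have hf_mem : ∀ x ∈ feasibleSet G,
      f x = penalizedObjective φ g μ x - penalizedObjective φ g μ z := fun x hx =>
    Set.indicator_of_mem hx _
  have hf_meas : Measurable f := by
    rw [hf, ← Set.piecewise_eq_indicator]
    exact hcont.measurable_piecewise continuousOn_const hF.measurableSet
  have hlim : ∀ᵐ ω ∂P, Tendsto (fun t => f (y t ω)) atTop (𝓝 0) := by
    refine ae_tendsto_zero_of_drift hV_meas hy_meas hmem hν_cond hν_mean hC hγ_nonneg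
      (fun hs => not_tendsto_nhds_of_tendsto_atTop hγ_sum _ hs.hasSum.tendsto_sum_nat) hγ_sq
      hf_meas (fun x => Set.indicator_nonneg (fun x hx => sub_nonneg.2 (hzmin' x hx)) x)
      (M := max M₂ 0) (fun x => ?_) (z := z)
      (fun t ω => norm_sub_le_of_mem hD (hmem t ω) hz) hB0 (fun ω T => ?_)
      (L := CΦ * B) fun ω t => ?_
    · by_cases hx : x ∈ feasibleSet G
      · rw [hf_mem x hx]
        exact ((le_abs_self _).trans (hM₂ x hx)).trans (le_max_left _ _)
      · rw [hf, Set.indicator_of_notMem hx]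
        exact le_max_right _ _
    · simp_rw [fun t => hf_mem _ (hmem t ω)]
      exact (hB _ _ _ (h_run ω)).2 z hz T
    · rw [hf_mem _ (hmem t ω), hf_mem _ (hmem (t + 1) ω)]
      have h1 := hΦ.dist_le_mul _ (hmem (t + 1) ω) _ (hmem t ω)
      rw [Real.dist_eq, dist_eq_norm] at h1
      have h2 := mul_le_mul_of_nonneg_left ((hB _ _ _ (h_run ω)).1 t) CΦ.coe_nonneg
      have h3 := (le_abs_self _).trans (h1.trans h2)
      rw [← mul_assoc] at h3
      linarith
  filter_upwards [hlim] with ω hω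
  exact tendsto_infDist_minimizers hF hΦ.continuousOn hzmin' (fun t => hmem t ω)
    (hω.congr fun t => hf_mem _ (hmem t ω))
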